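/- An $\mathsf{S5}_2$-algebra is a Boolean algebra $B$ with two $\mathsf{S5}$-possibility operators $\exists_1,\exists_2$ (each satisfies $\exists 0=0$, $\exists(a\vee b)=\exists a\vee\exists b$, $a\le\exists a$, $\exists\exists a\le\exists a$, $\exists{-}\exists a\le{-}\exists a$), with no further axioms; $\mathbb{S}5_2$ is the variety of all of them. An $\mathsf{MS4}$-algebra is a Boolean algebra with an $\mathsf{S4}$-possibility operator $\lozenge$ and an $\mathsf{S5}$-possibility operator $\exists$ such that $\exists\lozenge a\le\lozenge\exists a$. Write $\square=-\lozenge-$ and $\forall=-\exists-$. $\mathbf{MS4_S}[2]$ is the variety of all $\mathsf{MS4}$-algebras that satisfy $\lozenge\exists\square\forall a\le\square\forall a$ and have depth at most $2$, i.e. satisfy $\lozenge(\square b\wedge\neg(\lozenge\square a\to\square a))\le\square b$. For an $\mathsf{S5}_2$-algebra $\mathfrak A=(B,\exists_1,\exists_2)$ let $X$ be the Stone space of ultrafilters of $B$, and for $i=1,2$ let $x\mathrel{E_i}y$ iff $x$ and $y$ contain the same fixpoints of $\exists_i$. Let $\mathcal L=X/E_2$ with the quotient topology, and let $T(\mathfrak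 A_*)=(X\sqcup\mathcal L,R,E)$ (the "top-rail" frame), where $X\sqcup\mathcal L$ is the topological disjoint union, $R=E_1\cup(X\times\mathcal L)\cup(\mathcal L\times\mathcal L)$, and $E$ is the smallest equivalence relation containing $E_2$ and all pairs $(x,\alpha)$ with $x\in X$, $\alpha\in\mathcal L$, $x\in\alpha$. Let $T(\mathfrak A)$ be the Boolean algebra of clopen subsets of $X\sqcup\mathcal L$ with $\lozenge U=R^{-1}(U)$ and $\exists U=E(U)$. For a variety $\mathbb V\subseteq\mathbb{S}5_2$ put $$T(\mathbb V)=HSP\{T(\mathfrak A): \mathfrak A\in\mathbb V \text{ subdirectly irreducible}\}.$$ **Theorem.** For every variety $\mathbb V\subseteq\mathbb{S}5_2$, the class $T(\mathbb V)$ is a variety contained in $\mathbf{MS4_S}[2]$, and $\mathbb V$ is locally finite if and only if $T(\mathbb V)$ is locally finite. (A variety is locally finite if every finitely generated subalgebra of each of its members is finite.) -/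

import Mathlib

open Set TopologicalSpace

universe u

namespace Bimodal

/-! ### Bimodal algebras, homomorphisms, subalgebras, congruences -/

/-- A Boolean algebra with two unary operations: the algebras of the common signature of
`S5₂`-algebras and `MS4`-algebras. The laws are imposed below by `S52` and `MS4`. -/
structure Alg : Type (u + 1) where
  carrier : Type u
  [str : BooleanAlgebra carrier]
  dia₁ : carrier → carrier
  dia₂ : carrier → carrier

attribute [instance] Alg.str

instance : CoeSort Alg.{u} (Type u) := ⟨Alg.carrier⟩

namespace Alg

/-- The dual of the first operation. -/
def box₁ (A : Alg.{u}) (a : A) : A := (A.dia₁ aᶜ)ᶜ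

/-- The dual of the second operation. -/
def box₂ (A : Alg.{u}) (a : A) : A := (A.dia₂ aᶜ)ᶜ

/-- Homomorphisms: maps that preserve all operations of the signature. -/
structure Hom (A B : Alg.{u}) extends BoundedLatticeHom A B where
  map_dia₁ : ∀ a, toFun (A.dia₁ a) = B.dia₁ (toFun a)
  map_dia₂ : ∀ a, toFun (A.dia₂ a) = B.dia₂ (toFun a)

/-- The product of a family of algebras, with coordinatewise operations. -/
abbrev prod {ι : Type u} (A : ι → Alg.{u}) : Alg.{u} where
  carrier := ∀ i, A i
  dia₁ := fun a i => (A i).dia₁ (a i)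
  dia₂ := fun a i => (A i).dia₂ (a i)

/-- Subalgebras. -/
structure Subalg (A : Alg.{u}) extends BooleanSubalgebra A where
  dia₁_mem : ∀ a ∈ carrier, A.dia₁ a ∈ carrier
  dia₂_mem : ∀ a ∈ carrier, A.dia₂ a ∈ carrier

/-- The universe of the subalgebra generated by `s`. -/
def generated (A : Alg.{u}) (s : Set A) : Set A :=
  {a | ∀ B : A.Subalg, s ⊆ B.carrier → a ∈ B.carrier}

/-- An algebra is locally finite if all its finitely generated subalgebras are finite. -/
def IsLocallyFinite (A : Alg.{u}) : Prop :=
  ∀ s : Set A, s.Finite → (A.generated s).Finite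

/-- Congruences: equivalence relations compatible with all operations. -/
structure Congruence (A : Alg.{u}) extends Setoid A where
  sup : ∀ {a b c d}, r a b → r c d → r (a ⊔ c) (b ⊔ d)
  inf : ∀ {a b c d}, r a b → r c d → r (a ⊓ c) (b ⊓ d)
  compl : ∀ {a b}, r a b → r aᶜ bᶜ
  dia₁ : ∀ {a b}, r a b → r (A.dia₁ a) (A.dia₁ b)
  dia₂ : ∀ {a b}, r a b → r (A.dia₂ a) (A.dia₂ b)

/-- The congruence is not the identity relation. -/
def Congruence.IsNontrivial {A : Alg.{u}} (θ : A.Congruence) : Prop :=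
  ∃ a b, θ.r a b ∧ a ≠ b

/-- An algebra is subdirectly irreducible if it has a least nontrivial congruence. -/
def IsSubdirectlyIrreducible (A : Alg.{u}) : Prop :=
  ∃ μ : A.Congruence, μ.IsNontrivial ∧
    ∀ θ : A.Congruence, θ.IsNontrivial → ∀ a b, μ.r a b → θ.r a b

end Alg

/-! ### Class operators and varieties -/

/-- Homomorphic images of members of `K`. -/
def opH (K : Set Alg.{u}) : Set Alg.{u} :=
  {B | ∃ A ∈ K, ∃ f : A.Hom B, Function.Surjective f.toFun}

/-- Algebras isomorphic to subalgebras of members of `K`. -/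
def opS (K : Set Alg.{u}) : Set Alg.{u} :=
  {B | ∃ A ∈ K, ∃ f : B.Hom A, Function.Injective f.toFun}

/-- Algebras isomorphic to products of members of `K` (the empty product included). -/
def opP (K : Set Alg.{u}) : Set Alg.{u} :=
  {B | ∃ (ι : Type u) (A : ι → Alg.{u}), (∀ i, A i ∈ K) ∧
    ∃ f : B.Hom (Alg.prod A), Function.Bijective f.toFun}

/-- A variety: a class closed under homomorphic images, subalgebras and products. -/
structure IsVariety (V : Set Alg.{u}) : Prop where
  opH_subset : opH V ⊆ V
  opS_subset : opS V ⊆ V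
  opP_subset : opP V ⊆ V

/-- A class of algebras is locally finite if all its members are. -/
def IsLocallyFiniteClass (V : Set Alg.{u}) : Prop :=
  ∀ A ∈ V, A.IsLocallyFinite

/-! ### The varieties `S5₂`, `MS4`, `MS4_S` and `MS4_S[n]` -/

/-- `d` is an `S4`-possibility operator. -/
structure IsS4Op {B : Type u} [BooleanAlgebra B] (d : B → B) : Prop where
  bot : d ⊥ = ⊥
  sup : ∀ a b, d (a ⊔ b) = d a ⊔ d b
  le : ∀ a, a ≤ d a
  idem : ∀ a, d (d a) ≤ d a

/-- `d` is an `S5`-possibility operator. -/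
structure IsS5Op {B : Type u} [BooleanAlgebra B] (d : B → B) : Prop extends IsS4Op d where
  sym : ∀ a, d (d aᶜ)ᶜ ≤ (d aᶜ)ᶜ

/-- The class of `S5₂`-algebras: both operations are `S5`-operators (no further axioms). -/
def S52 : Set Alg.{u} := {A | IsS5Op A.dia₁ ∧ IsS5Op A.dia₂}

/-- The class of `MS4`-algebras; `dia₁` is the `S4`-modality `◇`, `dia₂` is the `S5`-modality `∃`. -/
def MS4 : Set Alg.{u} :=
  {A | IsS4Op A.dia₁ ∧ IsS5Op A.dia₂ ∧ ∀ a, A.dia₂ (A.dia₁ a) ≤ A.dia₁ (A.dia₂ a)}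

/-- The class of `MS4_S`-algebras: `MS4`-algebras with `◇∃□∀a ≤ □∀a`. -/
def MS4S : Set Alg.{u} :=
  {A | A ∈ MS4 ∧ ∀ a, A.dia₁ (A.dia₂ (A.box₁ (A.box₂ a))) ≤ A.box₁ (A.box₂ a)}

/-- The value of the formula `Pₙ` bounding the depth by `n`: `P₁ = ◇□q₁ → □q₁` and
`Pₙ = ◇(□qₙ ∧ ¬Pₙ₋₁) → □qₙ`. Setting `P₀ = ⊥` makes the first clause a case of the second. -/
def depthTerm (A : Alg.{u}) (q : ℕ → A) : ℕ → A
  | 0 => ⊥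
  | n + 1 => A.dia₁ (A.box₁ (q (n + 1)) ⊓ (depthTerm A q n)ᶜ) ⇨ A.box₁ (q (n + 1))

/-- `MS4_S[n]`: the `MS4_S`-algebras of depth at most `n`. -/
def MS4SDepth (n : ℕ) : Set Alg.{u} :=
  {A | A ∈ MS4S ∧ ∀ q : ℕ → A, depthTerm A q n = ⊤}

/-! ### Descriptive frames -/

/-- The inverse image `R⁻¹(U)`. -/
def relPre {X : Type u} (R : X → X → Prop) (U : Set X) : Set X := {y | ∃ x ∈ U, R y x}

/-- Continuous relations: point-closed, and inverse images of clopen sets are clopen. -/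
structure IsContinuousRel {X : Type u} [TopologicalSpace X] (R : X → X → Prop) : Prop where
  isClosed : ∀ x, IsClosed {y | R x y}
  isClopen : ∀ U, IsClopen U → IsClopen (relPre R U)

/-- A Stone space with two continuous relations. (For compact Hausdorff spaces,
zero-dimensional and totally disconnected mean the same.) -/
structure Frame : Type (u + 1) where
  carrier : Type u
  [top : TopologicalSpace carrier]
  [compact : CompactSpace carrier]
  [t2 : T2Space carrier]
  [totDisc : TotallyDisconnectedSpace carrier]
  rel₁ : carrier → carrier → Prop
  rel₂ : carrier → carrier → Prop
  cont₁ : IsContinuousRel rel₁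
  cont₂ : IsContinuousRel rel₂

attribute [instance] Frame.top Frame.compact Frame.t2 Frame.totDisc

instance : CoeSort Frame.{u} (Type u) := ⟨Frame.carrier⟩

/-- Descriptive `S5₂`-frames. -/
structure S52Frame : Type (u + 1) extends Frame.{u} where
  equiv₁ : Equivalence rel₁
  equiv₂ : Equivalence rel₂

/-- Descriptive `MS4`-frames; `rel₁` is the quasi-order `R`, `rel₂` is the equivalence `E`. -/
structure MS4Frame : Type (u + 1) extends Frame.{u} where
  refl₁ : ∀ x, rel₁ x x
  trans₁ : ∀ {x y z}, rel₁ x y → rel₁ y z → rel₁ x z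
  equiv₂ : Equivalence rel₂
  comm : ∀ {x y y'}, rel₂ x y → rel₁ y y' → ∃ x', rel₁ x x' ∧ rel₂ x' y'

/-- The dual algebra `F^*` of a frame: clopen sets with the dual operators of the relations. -/
abbrev Frame.dual (F : Frame.{u}) : Alg.{u} where
  carrier := Clopens F
  dia₁ := fun U => ⟨relPre F.rel₁ U, F.cont₁.isClopen U U.isClopen⟩
  dia₂ := fun U => ⟨relPre F.rel₂ U, F.cont₂.isClopen U U.isClopen⟩

/-! ### The dual frame of an `S5₂`-algebra -/

/-- Ultrafilters of a Boolean algebra. -/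
@[ext]
structure Uf (B : Type u) [BooleanAlgebra B] : Type u where
  carrier : Set B
  top_mem : ⊤ ∈ carrier
  inf_mem : ∀ {a b}, a ∈ carrier → b ∈ carrier → a ⊓ b ∈ carrier
  mem_of_le : ∀ {a b}, a ≤ b → a ∈ carrier → b ∈ carrier
  compl_mem_iff : ∀ {a}, aᶜ ∈ carrier ↔ a ∉ carrier

namespace Uf

variable {B : Type u} [BooleanAlgebra B]

/-- The basic set of all ultrafilters containing `a`. -/
def basic (a : B) : Set (Uf B) := {x | a ∈ x.carrier}

/-- The Stone topology. -/
instance : TopologicalSpace (Uf B) := TopologicalSpace.generateFrom (Set.range basic)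

theorem basic_compl (a : B) : (basic a)ᶜ = basic aᶜ := by
  ext x; exact x.compl_mem_iff.symm

theorem isClopen_basic (a : B) : IsClopen (basic a) := by
  have h : ∀ b : B, IsOpen (basic b) := fun b => isOpen_generateFrom_of_mem ⟨b, rfl⟩
  refine ⟨⟨?_⟩, h a⟩
  rw [basic_compl]; exact h _

theorem basic_inf (a b : B) : basic (a ⊓ b) = basic a ∩ basic b := by
  ext x
  exact ⟨fun h => ⟨x.mem_of_le inf_le_left h, x.mem_of_le inf_le_right h⟩,
    fun h => x.inf_mem h.1 h.2⟩

theorem isTopologicalBasis : IsTopologicalBasis (Set.range (basic (B := B))) where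
  exists_subset_inter := by
    rintro _ ⟨a, rfl⟩ _ ⟨b, rfl⟩ x hx
    exact ⟨_, ⟨a ⊓ b, rfl⟩, by rwa [basic_inf], by rw [basic_inf]⟩
  sUnion_eq := by
    refine Set.eq_univ_of_forall fun x => ⟨_, ⟨⊤, rfl⟩, x.top_mem⟩
  eq_generateFrom := rfl

instance : TotallySeparatedSpace (Uf B) := by
  rw [totallySeparatedSpace_iff_exists_isClopen]
  intro x y hxy
  by_contra! hcon
  refine hxy (Uf.ext (Set.ext fun a => ?_))
  constructor
  · intro ha
    have := hcon (basic a) (isClopen_basic a) ha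
    simpa [basic] using this
  · intro ha
    by_contra hx
    have := hcon (basic aᶜ) (isClopen_basic _) (x.compl_mem_iff.2 hx)
    simp only [Set.mem_compl_iff, not_not] at this
    exact y.compl_mem_iff.1 this ha

instance : CompactSpace (Uf B) := by
  refine ⟨isCompact_iff_ultrafilter_le_nhds.2 fun 𝓤 _ => ?_⟩
  refine ⟨⟨{a | basic a ∈ 𝓤}, ?_, ?_, ?_, ?_⟩, Set.mem_univ _, ?_⟩
  · have : basic (⊤ : B) = Set.univ := Set.eq_univ_of_forall fun x => x.top_mem
    simp only [Set.mem_ofPred_eq, this]; exact Filter.univ_mem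
  · intro a b ha hb
    simp only [Set.mem_ofPred_eq, basic_inf] at *
    exact Filter.inter_mem ha hb
  · intro a b hab ha
    exact Filter.mem_of_superset ha fun x hx => x.mem_of_le hab hx
  · intro a
    simp only [Set.mem_ofPred_eq, ← basic_compl]
    exact Ultrafilter.compl_mem_iff_notMem
  · rw [nhds_generateFrom]
    simp only [le_iInf_iff, Filter.le_principal_iff]
    rintro _ ⟨hs, ⟨a, rfl⟩⟩
    exact hs

end Uf

/-- The dual relation of an `S5`-operator: two ultrafilters are related iff they contain the same
fixpoints. -/
def fixRel {B : Type u} [BooleanAlgebra B] (d : B → B) (x y : Uf B) : Prop :=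
  ∀ a, d a = a → (a ∈ x.carrier ↔ a ∈ y.carrier)

theorem fixRel_equivalence {B : Type u} [BooleanAlgebra B] (d : B → B) :
    Equivalence (fixRel d) where
  refl := fun _ _ _ => Iff.rfl
  symm := fun h a ha => (h a ha).symm
  trans := fun h k a ha => (h a ha).trans (k a ha)

section S5Op

variable {B : Type u} [BooleanAlgebra B] {d : B → B}

theorem IsS4Op.mono (h : IsS4Op d) {a b : B} (hab : a ≤ b) : d a ≤ d b := by
  have := h.sup a b
  rw [sup_eq_right.2 hab] at this
  exact this ▸ le_sup_left

theorem IsS4Op.fix (h : IsS4Op d) (a : B) : d (d a) = d a :=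
  le_antisymm (h.idem a) (h.le _)

theorem IsS4Op.fix_inf (h : IsS4Op d) {a b : B} (ha : d a = a) (hb : d b = b) :
    d (a ⊓ b) = a ⊓ b := by
  refine le_antisymm (le_inf ?_ ?_) (h.le _)
  · exact (h.mono inf_le_left).trans_eq ha
  · exact (h.mono inf_le_right).trans_eq hb

theorem IsS5Op.fix_compl (h : IsS5Op d) {a : B} (ha : d a = a) : d aᶜ = aᶜ := by
  refine le_antisymm ?_ (h.le _)
  have := h.sym aᶜ
  rwa [compl_compl, ha] at this

theorem relPre_basic (h : IsS5Op d) (a : B) :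
    relPre (fixRel d) (Uf.basic a) = Uf.basic (d a) := by
  ext x
  constructor
  · rintro ⟨y, hy, hxy⟩
    exact (hxy (d a) (h.toIsS4Op.fix a)).2 (y.mem_of_le (h.le a) hy)
  · intro hx
    let F : Set B := {b | ∃ c ∈ x.carrier, d c = c ∧ c ⊓ a ≤ b}
    have hF : Order.IsPFilter F := by
      refine Order.IsPFilter.of_def ⟨⊤, ⊤, x.top_mem, top_le_iff.1 (h.le _), le_top⟩ ?_ ?_
      · rintro b₁ ⟨c₁, h₁, f₁, l₁⟩ b₂ ⟨c₂, h₂, f₂, l₂⟩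
        refine ⟨b₁ ⊓ b₂, ⟨c₁ ⊓ c₂, x.inf_mem h₁ h₂, h.toIsS4Op.fix_inf f₁ f₂, ?_⟩,
          inf_le_left, inf_le_right⟩
        exact le_inf ((inf_le_inf_right _ inf_le_left).trans l₁)
          ((inf_le_inf_right _ inf_le_right).trans l₂)
      · rintro b₁ b₂ hb ⟨c₁, h₁, f₁, l₁⟩
        exact ⟨c₁, h₁, f₁, l₁.trans hb⟩
    have hbot : (⊥ : B) ∉ F := by
      rintro ⟨c, hc, fc, lc⟩
      have h1 : a ≤ cᶜ := le_compl_iff_disjoint_left.2 (disjoint_iff_inf_le.2 lc)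
      have h2 : d a ≤ cᶜ := (h.toIsS4Op.mono h1).trans_eq (h.fix_compl fc)
      exact x.compl_mem_iff.1 (x.mem_of_le h2 hx) hc
    have hdis : Disjoint ((hF.toPFilter : Order.PFilter B) : Set B)
        ((Order.Ideal.principal (⊥ : B) : Order.Ideal B) : Set B) := by
      rw [Set.disjoint_left]
      intro b hb hb'
      have hb0 : b = ⊥ := le_bot_iff.1 hb'
      exact hbot (hb0 ▸ hb)
    obtain ⟨J, hJ, -, hFJ⟩ := DistribLattice.prime_ideal_of_disjoint_filter_ideal hdis
    have hFJ' : ∀ b ∈ F, b ∉ J := fun b hb => Set.disjoint_left.1 hFJ hb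
    have htop : (⊤ : B) ∉ J :=
      hFJ' ⊤ ⟨⊤, x.top_mem, top_le_iff.1 (h.le _), le_top⟩
    let y : Uf B :=
      { carrier := {b | b ∉ J}
        top_mem := htop
        inf_mem := fun {b c} hb hc hbc => (hJ.mem_or_mem hbc).elim hb hc
        mem_of_le := fun {b c} hbc hb hc => hb (J.lower hbc hc)
        compl_mem_iff := fun {b} => by
          simp only [Set.mem_ofPred_eq, not_not]
          constructor
          · intro hb
            exact (hJ.mem_or_compl_mem (x := b)).resolve_right hb
          · intro hb hb'
            exact htop (by simpa using Order.Ideal.sup_mem hb hb') }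
    have hsub : ∀ b ∈ F, b ∈ y.carrier := hFJ'
    refine ⟨y, hsub a ⟨⊤, x.top_mem, top_le_iff.1 (h.le _), inf_le_right⟩, fun c fc => ?_⟩
    constructor
    · intro hc
      exact hsub c ⟨c, hc, fc, inf_le_left⟩
    · intro hc
      by_contra hcx
      exact y.compl_mem_iff.1
        (hsub cᶜ ⟨cᶜ, x.compl_mem_iff.2 hcx, h.fix_compl fc, inf_le_left⟩) hc

theorem isContinuousRel_fixRel (h : IsS5Op d) : IsContinuousRel (fixRel d) where
  isClosed := fun x => by
    have : {y | fixRel d x y} =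
        ⋂ a, ⋂ (_ : d a = a), {y : Uf B | a ∈ x.carrier ↔ y ∈ Uf.basic a} := by
      ext y; simp [fixRel, Uf.basic]
    rw [this]
    refine isClosed_iInter fun a => isClosed_iInter fun _ => ?_
    by_cases ha : a ∈ x.carrier
    · simpa [ha] using (Uf.isClopen_basic a).isClosed
    · simp only [ha, false_iff]; exact (Uf.isClopen_basic a).compl.isClosed
  isClopen := fun U hU => by
    obtain ⟨s, hs, rfl⟩ := eq_finite_iUnion_of_isTopologicalBasis_of_isCompact_open
      (Uf.basic (B := B)) Uf.isTopologicalBasis U hU.isClosed.isCompact hU.isOpen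
    have : relPre (fixRel d) (⋃ a ∈ s, Uf.basic a) =
        ⋃ a ∈ s, relPre (fixRel d) (Uf.basic a) := by
      ext x
      simp only [relPre, Set.mem_ofPred_eq, Set.mem_iUnion]
      constructor
      · rintro ⟨y, ⟨a, ha, hy⟩, hxy⟩; exact ⟨a, ha, y, hy, hxy⟩
      · rintro ⟨a, ha, y, hy, hxy⟩; exact ⟨y, ⟨a, ha, hy⟩, hxy⟩
    rw [this]
    refine hs.isClopen_biUnion fun a _ => ?_
    rw [relPre_basic h]; exact Uf.isClopen_basic _

end S5Op

/-- The dual frame `A_*` of an `S5₂`-algebra. -/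
abbrev dualFrame (A : Alg.{u}) (hA : A ∈ S52) : S52Frame.{u} where
  carrier := Uf A
  rel₁ := fixRel A.dia₁
  rel₂ := fixRel A.dia₂
  cont₁ := isContinuousRel_fixRel hA.1
  cont₂ := isContinuousRel_fixRel hA.2
  equiv₁ := fixRel_equivalence _
  equiv₂ := fixRel_equivalence _

/-! ### The top-rail construction -/

namespace S52Frame

variable (F : S52Frame.{u})

/-- The second equivalence relation as a setoid. -/
def setoid₂ : Setoid F.carrier := ⟨F.rel₂, F.equiv₂⟩

/-- The quotient space `L = X / E₂`. -/
abbrev Rail : Type u := Quotient F.setoid₂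

/-- The disjoint union of `X` and `L`, with the disjoint union topology. -/
abbrev Total : Type u := F.carrier ⊕ F.Rail

/-- `R = E₁ ∪ (X × L) ∪ (L × L)`. -/
def railR : F.Total → F.Total → Prop
  | .inl x, .inl y => F.rel₁ x y
  | .inl _, .inr _ => True
  | .inr _, .inr _ => True
  | .inr _, .inl _ => False

/-- The generating pairs for `E`: the pairs in `E₂`, and the pairs `(x, α)` with `x ∈ α`. -/
inductive RailGen : F.Total → F.Total → Prop
  | base (x y : F.carrier) : F.rel₂ x y → RailGen (.inl x) (.inl y)
  | up (x : F.carrier) (α : F.Rail) : (Quotient.mk F.setoid₂ x : F.Rail) = α →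
      RailGen (.inl x) (.inr α)

/-- `E` is the smallest equivalence relation containing the generating pairs. -/
def railE : F.Total → F.Total → Prop := Relation.EqvGen F.RailGen

/-- The element of the rail in the `E`-class of a given point. -/
def toRail : F.Total → F.Rail := Sum.elim (Quotient.mk F.setoid₂) id

theorem railE_iff (p q : F.Total) : F.railE p q ↔ F.toRail p = F.toRail q := by
  constructor
  · intro h
    induction h with
    | rel p q h =>
      cases h with
      | base x y h => exact Quotient.sound (s := F.setoid₂) h
      | up x α h => exact h
    | refl => rfl
    | symm _ _ _ ih => exact ih.symm
    | trans _ _ _ _ _ ih₁ ih₂ => exact ih₁.trans ih₂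
  · intro h
    have key : ∀ p : F.Total, F.railE p (.inr (F.toRail p)) := by
      rintro (x | α)
      · exact .rel _ _ (.up x _ rfl)
      · exact .refl _
    exact (key p).trans _ _ _ (h ▸ (key q).symm)

theorem isClopen_quot_iff (V : Set F.Rail) :
    IsClopen V ↔ IsClopen ((Quotient.mk F.setoid₂) ⁻¹' V) := by
  have hq : Topology.IsQuotientMap (Quotient.mk F.setoid₂) := isQuotientMap_quotient_mk'
  exact (hq.isClopen_preimage).symm

theorem isClopen_sum_iff (U : Set F.Total) :
    IsClopen U ↔ IsClopen (Sum.inl ⁻¹' U) ∧ IsClopen (Sum.inr ⁻¹' U) := by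
  simp only [IsClopen, isOpen_sum_iff, isClosed_sum_iff]
  tauto

theorem isClopen_image {U : Set F.carrier} (hU : IsClopen U) :
    IsClopen ((Quotient.mk F.setoid₂) '' U) := by
  rw [isClopen_quot_iff]
  convert F.cont₂.isClopen U hU using 1
  ext x
  constructor
  · rintro ⟨y, hy, h⟩
    exact ⟨y, hy, F.equiv₂.symm (Quotient.exact (s := F.setoid₂) h)⟩
  · rintro ⟨y, hy, h⟩
    exact ⟨y, hy, Quotient.sound (s := F.setoid₂) (F.equiv₂.symm h)⟩

instance : TotallySeparatedSpace F.Rail := by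
  rw [totallySeparatedSpace_iff_exists_isClopen]
  intro α β
  induction α using Quotient.inductionOn with | _ x => ?_
  induction β using Quotient.inductionOn with | _ y => ?_
  intro hxy
  have hx : x ∈ {z | F.rel₂ y z}ᶜ := fun h =>
    hxy (Quotient.sound (s := F.setoid₂) (F.equiv₂.symm h))
  obtain ⟨V, hV, hxV, hVy⟩ := compact_exists_isClopen_in_isOpen
    (F.cont₂.isClosed y).isOpen_compl hx
  refine ⟨_, F.isClopen_image hV, ⟨x, hxV, rfl⟩, ?_⟩
  rintro ⟨z, hz, h⟩
  exact hVy hz (F.equiv₂.symm (Quotient.exact (s := F.setoid₂) h))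

instance : TotallyDisconnectedSpace F.Total :=
  have : TotallySeparatedSpace F.Total := by
    rw [totallySeparatedSpace_iff_exists_isClopen]
    have hinl : IsClopen (Set.range (Sum.inl : F.carrier → F.Total)) := by
      rw [isClopen_sum_iff]
      constructor
      · convert isClopen_univ; ext; simp
      · convert isClopen_empty; ext; simp
    rintro (x | α) (y | β) h
    · obtain ⟨U, hU, hx, hy⟩ := exists_isClopen_of_totally_separated
        (show x ≠ y from fun e => h (e ▸ rfl))
      refine ⟨Sum.inl '' U, ?_, ⟨x, hx, rfl⟩, ?_⟩
      · rw [isClopen_sum_iff]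
        constructor
        · rwa [Set.preimage_image_eq _ Sum.inl_injective]
        · convert isClopen_empty; ext; simp
      · rintro ⟨z, hz, e⟩; exact hy (Sum.inl_injective e ▸ hz)
    · exact ⟨_, hinl, ⟨x, rfl⟩, by simp⟩
    · exact ⟨_, hinl.compl, by simp, by simp⟩
    · obtain ⟨U, hU, hx, hy⟩ := exists_isClopen_of_totally_separated
        (show α ≠ β from fun e => h (e ▸ rfl))
      refine ⟨Sum.inr '' U, ?_, ⟨α, hx, rfl⟩, ?_⟩
      · rw [isClopen_sum_iff]
        constructor
        · convert isClopen_empty; ext; simp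
        · rwa [Set.preimage_image_eq _ Sum.inr_injective]
      · rintro ⟨z, hz, e⟩; exact hy (Sum.inr_injective e ▸ hz)
  inferInstance

theorem isContinuousRel_railR : IsContinuousRel F.railR where
  isClosed := by
    rintro (x | α)
    · rw [isClosed_sum_iff]
      constructor
      · exact F.cont₁.isClosed x
      · convert isClosed_univ; ext; simp [railR]
    · rw [isClosed_sum_iff]
      constructor
      · convert isClosed_empty; ext; simp [railR]
      · convert isClosed_univ; ext; simp [railR]
  isClopen := by
    intro U hU
    rw [isClopen_sum_iff] at hU
    by_cases hV : ∃ α, (Sum.inr α : F.Total) ∈ U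
    · obtain ⟨α, hα⟩ := hV
      convert isClopen_univ
      refine Set.eq_univ_of_forall fun p => ⟨.inr α, hα, ?_⟩
      cases p <;> trivial
    · rw [isClopen_sum_iff]
      constructor
      · convert F.cont₁.isClopen _ hU.1 using 1
        ext x
        constructor
        · rintro ⟨y | β, hy, h⟩
          · exact ⟨y, hy, h⟩
          · exact (hV ⟨β, hy⟩).elim
        · rintro ⟨y, hy, h⟩
          exact ⟨.inl y, hy, h⟩
      · convert isClopen_empty
        refine Set.eq_empty_of_forall_notMem fun α => ?_
        rintro ⟨y | β, hy, h⟩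
        · exact h
        · exact hV ⟨β, hy⟩

theorem isContinuousRel_railE : IsContinuousRel F.railE where
  isClosed := by
    intro p
    have hc : Continuous F.toRail := by
      refine continuous_quotient_mk'.sumElim continuous_id
    have : {q | F.railE p q} = F.toRail ⁻¹' {F.toRail p} := by
      ext q; simp [railE_iff, eq_comm]
    rw [this]
    exact isClosed_singleton.preimage hc
  isClopen := by
    intro U hU
    rw [isClopen_sum_iff] at hU
    have hW : IsClopen ((Quotient.mk F.setoid₂) '' (Sum.inl ⁻¹' U) ∪ Sum.inr ⁻¹' U) :=
      (F.isClopen_image hU.1).union hU.2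
    have : relPre F.railE U =
        F.toRail ⁻¹' ((Quotient.mk F.setoid₂) '' (Sum.inl ⁻¹' U) ∪ Sum.inr ⁻¹' U) := by
      ext p
      constructor
      · rintro ⟨y | β, hy, h⟩
        · exact Or.inl ⟨y, hy, ((F.railE_iff _ _).1 h).symm⟩
        · refine Or.inr ?_
          have e : F.toRail p = β := (F.railE_iff _ _).1 h
          show Sum.inr (F.toRail p) ∈ U
          rw [e]; exact hy
      · rintro (⟨y, hy, h⟩ | h)
        · exact ⟨.inl y, hy, (F.railE_iff _ _).2 h.symm⟩
        · exact ⟨.inr (F.toRail p), h, (F.railE_iff _ _).2 rfl⟩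
    rw [this, isClopen_sum_iff]
    exact ⟨(F.isClopen_quot_iff _).1 hW, hW⟩

/-- The top-rail frame `T(F) = (X ∪ L, R, E)`. -/
abbrev topRail : MS4Frame.{u} where
  carrier := F.Total
  rel₁ := F.railR
  rel₂ := F.railE
  cont₁ := F.isContinuousRel_railR
  cont₂ := F.isContinuousRel_railE
  refl₁ := by
    rintro (x | α)
    · exact F.equiv₁.refl x
    · trivial
  trans₁ := by
    rintro (x | α) (y | β) (z | γ) h k
    · exact F.equiv₁.trans h k
    all_goals trivial
  equiv₂ := Relation.EqvGen.is_equivalence _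
  comm := by
    intro p _ q _ _
    refine ⟨.inr (F.toRail q), ?_, (F.railE_iff _ _).2 rfl⟩
    cases p <;> trivial

end S52Frame

/-! ### The translation of varieties -/

/-- `T(A) = (T(A_*))^*` for an `S5₂`-algebra `A`. -/
abbrev translateAlg (A : Alg.{u}) (hA : A ∈ S52) : Alg.{u} :=
  (dualFrame A hA).topRail.toFrame.dual

/-- `T(V) = HSP {T(A) | A ∈ V subdirectly irreducible}`, for a class `V` of `S5₂`-algebras. -/
def translate (V : Set Alg.{u}) (hV : V ⊆ S52) : Set Alg.{u} :=
  opH (opS (opP {B | ∃ (A : Alg.{u}) (hA : A ∈ V),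
    A.IsSubdirectlyIrreducible ∧ B = translateAlg A (hV hA)}))

end Bimodal

/-!
The class `T(V)` is of the form `HSP(K)`, hence a variety (`Bimodal.isVariety_HSP`), and it lies in
`MS4_S[2]` because the latter is closed under `HSP` and contains the algebra of every top-rail
frame: such a frame consists of the `E₁`-clusters of `X` below one final cluster, the rail, which
meets every `E`-class (`Bimodal.S52Frame.topRail_dual_mem_MS4SDepth`).

For local finiteness, an element of `T(A)` is treated as a pair `(a, w)` of elements of `A`, where
`a` gives its part in `X` and `w` the preimage of its part in the rail (`Bimodal.Codes`). On pairs,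
`∃(a, w) = (∃₂a ∨ w, ∃₂a ∨ w)`, while `◇(a, w)` is `(∃₁a, 0)` if `w = 0`, and `(1, 1)` otherwise.

Suppose that `V` is locally finite. A member of `T(V)` is a homomorphic image of a subalgebra of a
product of algebras `T(Aᵢ)` with `Aᵢ ∈ V` subdirectly irreducible, so it suffices to treat the
product itself. The product of the `Aᵢ` lies in `V`, so the codes of finitely many elements
generate a finite subalgebra `S` of it, and the elements with codes in `S` are closed under all
operations. The only critical one is `◇`, which needs the element of `S` that is `1` in the
coordinates where `w` is nonzero, and `0` in the others. A maximal element of the finite set of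
those `z ≥ w` in `S` that vanish where `w` does is a common fixpoint of `∃₁` and `∃₂`
(`Bimodal.exists_common_fixpoint`), and in a subdirectly irreducible algebra common fixpoints are
`0` or `1` (`Bimodal.Alg.IsSubdirectlyIrreducible.eq_bot_or_eq_top`).

Conversely, suppose that `T(V)` is locally finite. By Birkhoff's theorem
(`Bimodal.Alg.exists_subdirect_representation`), a member `B` of `V` embeds into a product of
subdirectly irreducible members `Aᵢ` of `V`. Each `Aᵢ` is the relativization of `T(Aᵢ)` to the clopen
set `X`, so the subalgebra of `B` generated by a finite set maps injectively into the subalgebra of the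
product of the `T(Aᵢ)` generated by the images of its elements and the element with all
coordinates `X`.
-/

namespace Bimodal

/-! ### Homomorphisms and subalgebras -/

namespace Alg

variable {A B C : Alg.{u}}

namespace Hom

/-- A map that preserves joins, complements and both operators is a homomorphism. -/
def ofSupCompl (f : A → B) (sup : ∀ a b, f (a ⊔ b) = f a ⊔ f b) (compl : ∀ a, f aᶜ = (f a)ᶜ)
    (dia₁ : ∀ a, f (A.dia₁ a) = B.dia₁ (f a)) (dia₂ : ∀ a, f (A.dia₂ a) = B.dia₂ (f a)) :
    A.Hom B :=
  have top : f ⊤ = ⊤ := by rw [← sup_compl_eq_top (x := (⊥ : A)), sup, compl, sup_compl_eq_top]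
  { toFun := f
    map_sup' := sup
    map_inf' := fun a b => by
      have h : a ⊓ b = (aᶜ ⊔ bᶜ)ᶜ := by simp
      rw [h, compl, sup, compl, compl, compl_sup, compl_compl, compl_compl]
    map_top' := top
    map_bot' := by
      change f ⊥ = ⊥
      rw [← compl_top, compl, top, compl_top]
    map_dia₁ := dia₁
    map_dia₂ := dia₂ }

variable (f : A.Hom B)

theorem map_sup (a b : A) : f.toFun (a ⊔ b) = f.toFun a ⊔ f.toFun b := f.map_sup' a b

theorem map_inf (a b : A) : f.toFun (a ⊓ b) = f.toFun a ⊓ f.toFun b := f.map_inf' a b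

theorem map_bot : f.toFun ⊥ = ⊥ := f.map_bot'

theorem map_top : f.toFun ⊤ = ⊤ := f.map_top'

theorem map_compl (a : A) : f.toFun aᶜ = (f.toFun a)ᶜ := by
  refine (IsCompl.compl_eq ⟨disjoint_iff.2 ?_, codisjoint_iff.2 ?_⟩).symm
  · rw [← f.map_inf, inf_compl_self, f.map_bot]
  · rw [← f.map_sup, sup_compl_eq_top, f.map_top]

theorem map_himp (a b : A) : f.toFun (a ⇨ b) = f.toFun a ⇨ f.toFun b := by
  rw [himp_eq, himp_eq, f.map_sup, f.map_compl]

theorem map_box₁ (a : A) : f.toFun (A.box₁ a) = B.box₁ (f.toFun a) := by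
  simp only [box₁, f.map_compl, f.map_dia₁]

theorem map_box₂ (a : A) : f.toFun (A.box₂ a) = B.box₂ (f.toFun a) := by
  simp only [box₂, f.map_compl, f.map_dia₂]

theorem map_depthTerm (q : ℕ → A) (n : ℕ) :
    f.toFun (depthTerm A q n) = depthTerm B (fun k => f.toFun (q k)) n := by
  induction n with
  | zero => exact f.map_bot
  | succ n ih =>
    simp only [depthTerm, f.map_himp, f.map_dia₁, f.map_inf, f.map_box₁, f.map_compl, ih]

theorem mono {a b : A} (h : a ≤ b) : f.toFun a ≤ f.toFun b := by
  rw [← sup_eq_right] at h ⊢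
  rw [← f.map_sup, h]

/-- Composition of homomorphisms. -/
def comp (g : B.Hom C) (f : A.Hom B) : A.Hom C :=
  ofSupCompl (fun a => g.toFun (f.toFun a))
    (fun a b => by rw [f.map_sup, g.map_sup]) (fun a => by rw [f.map_compl, g.map_compl])
    (fun a => by rw [f.map_dia₁, g.map_dia₁]) (fun a => by rw [f.map_dia₂, g.map_dia₂])

/-- The identity homomorphism. -/
def id (A : Alg.{u}) : A.Hom A :=
  ofSupCompl (fun a => a) (fun _ _ => rfl) (fun _ => rfl) (fun _ => rfl) (fun _ => rfl)

/-- The homomorphism into a product with given components. -/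
def pi {ι : Type u} {B : ι → Alg.{u}} (f : ∀ i, A.Hom (B i)) : A.Hom (prod B) :=
  ofSupCompl (B := prod B) (fun a i => (f i).toFun a)
    (fun a b => funext fun i => (f i).map_sup a b) (fun a => funext fun i => (f i).map_compl a)
    (fun a => funext fun i => (f i).map_dia₁ a) (fun a => funext fun i => (f i).map_dia₂ a)

/-- The projections of a product. -/
def eval {ι : Type u} (B : ι → Alg.{u}) (i : ι) : (prod B).Hom (B i) :=
  ofSupCompl (A := prod B) (fun a => a i)
    (fun _ _ => rfl) (fun _ => rfl) (fun _ => rfl) (fun _ => rfl)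

/-- The factorization of `h` through an injective homomorphism `g` whose range contains that of
`h`. -/
noncomputable def lift (g : B.Hom C) (hg : Function.Injective g.toFun) (h : A.Hom C)
    (hr : ∀ a, ∃ b, g.toFun b = h.toFun a) : A.Hom B :=
  have key : ∀ a, g.toFun (hr a).choose = h.toFun a := fun a => (hr a).choose_spec
  ofSupCompl (fun a => (hr a).choose)
    (fun a b => hg <| by rw [g.map_sup, key, key, key, h.map_sup])
    (fun a => hg <| by rw [g.map_compl, key, key, h.map_compl])
    (fun a => hg <| by rw [g.map_dia₁, key, key, h.map_dia₁])
    (fun a => hg <| by rw [g.map_dia₂, key, key, h.map_dia₂])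

theorem lift_spec (g : B.Hom C) (hg : Function.Injective g.toFun) (h : A.Hom C)
    (hr : ∀ a, ∃ b, g.toFun b = h.toFun a) (a : A) :
    g.toFun ((lift g hg h hr).toFun a) = h.toFun a :=
  (hr a).choose_spec

end Hom

namespace Subalg

/-- A set closed under joins, complements and both operators, and containing `⊥`, is the universe
of a subalgebra. -/
def ofSupCompl (s : Set A) (bot : ⊥ ∈ s) (sup : ∀ a ∈ s, ∀ b ∈ s, a ⊔ b ∈ s)
    (compl : ∀ a ∈ s, aᶜ ∈ s) (dia₁ : ∀ a ∈ s, A.dia₁ a ∈ s) (dia₂ : ∀ a ∈ s, A.dia₂ a ∈ s) :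
    A.Subalg where
  carrier := s
  supClosed' := fun a ha b hb => sup a ha b hb
  infClosed' := fun a ha b hb => by
    have h : a ⊓ b = (aᶜ ⊔ bᶜ)ᶜ := by simp
    rw [h]
    exact compl _ (sup _ (compl _ ha) _ (compl _ hb))
  compl_mem' := fun {a} ha => compl a ha
  bot_mem' := bot
  dia₁_mem := dia₁
  dia₂_mem := dia₂

variable (S : A.Subalg)

theorem bot_mem : ⊥ ∈ S.carrier := S.bot_mem'

theorem sup_mem {a b : A} (ha : a ∈ S.carrier) (hb : b ∈ S.carrier) : a ⊔ b ∈ S.carrier :=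
  S.supClosed' ha hb

theorem inf_mem {a b : A} (ha : a ∈ S.carrier) (hb : b ∈ S.carrier) : a ⊓ b ∈ S.carrier :=
  S.infClosed' ha hb

theorem compl_mem {a : A} (ha : a ∈ S.carrier) : aᶜ ∈ S.carrier := S.compl_mem' ha

/-- A subalgebra as an algebra. -/
def toAlg : Alg.{u} where
  carrier := S.toBooleanSubalgebra
  dia₁ := fun a => ⟨A.dia₁ a.1, S.dia₁_mem _ a.2⟩
  dia₂ := fun a => ⟨A.dia₂ a.1, S.dia₂_mem _ a.2⟩

/-- The inclusion of a subalgebra. -/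
def incl : S.toAlg.Hom A :=
  Hom.ofSupCompl (A := S.toAlg) (fun a => a.1)
    (fun _ _ => rfl) (fun _ => rfl) (fun _ => rfl) (fun _ => rfl)

/-- The preimage of a subalgebra under a homomorphism. -/
def comap (f : A.Hom B) (S : B.Subalg) : A.Subalg :=
  ofSupCompl {a | f.toFun a ∈ S.carrier}
    (by simpa only [mem_ofPred_eq, f.map_bot] using S.bot_mem)
    (fun a ha b hb => by simpa only [mem_ofPred_eq, f.map_sup] using S.sup_mem ha hb)
    (fun a ha => by simpa only [mem_ofPred_eq, f.map_compl] using S.compl_mem ha)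
    (fun a ha => by simpa only [mem_ofPred_eq, f.map_dia₁] using S.dia₁_mem _ ha)
    (fun a ha => by simpa only [mem_ofPred_eq, f.map_dia₂] using S.dia₂_mem _ ha)

/-- The image of a subalgebra under a homomorphism. -/
def map (f : A.Hom B) (S : A.Subalg) : B.Subalg :=
  ofSupCompl (f.toFun '' S.carrier) ⟨⊥, S.bot_mem, f.map_bot⟩
    (by rintro _ ⟨a, ha, rfl⟩ _ ⟨b, hb, rfl⟩; exact ⟨_, S.sup_mem ha hb, f.map_sup a b⟩)
    (by rintro _ ⟨a, ha, rfl⟩; exact ⟨_, S.compl_mem ha, f.map_compl a⟩)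
    (by rintro _ ⟨a, ha, rfl⟩; exact ⟨_, S.dia₁_mem _ ha, f.map_dia₁ a⟩)
    (by rintro _ ⟨a, ha, rfl⟩; exact ⟨_, S.dia₂_mem _ ha, f.map_dia₂ a⟩)

/-- The range of a homomorphism. -/
def range (f : A.Hom B) : B.Subalg :=
  ofSupCompl (Set.range f.toFun) ⟨⊥, f.map_bot⟩
    (by rintro _ ⟨a, rfl⟩ _ ⟨b, rfl⟩; exact ⟨_, f.map_sup a b⟩)
    (by rintro _ ⟨a, rfl⟩; exact ⟨_, f.map_compl a⟩)
    (by rintro _ ⟨a, rfl⟩; exact ⟨_, f.map_dia₁ a⟩)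
    (by rintro _ ⟨a, rfl⟩; exact ⟨_, f.map_dia₂ a⟩)

/-- The subalgebra generated by a set. -/
def closure (s : Set A) : A.Subalg :=
  ofSupCompl (A.generated s) (fun S _ => S.bot_mem)
    (fun _ ha _ hb S hS => S.sup_mem (ha S hS) (hb S hS))
    (fun _ ha S hS => S.compl_mem (ha S hS))
    (fun _ ha S hS => S.dia₁_mem _ (ha S hS))
    (fun _ ha S hS => S.dia₂_mem _ (ha S hS))

theorem subset_closure (s : Set A) : s ⊆ (closure s).carrier := fun _ ha _ hS => hS ha

end Subalg

/-! ### Local finiteness of subalgebras and homomorphic images -/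

theorem IsLocallyFinite.of_injective (hB : B.IsLocallyFinite) (f : A.Hom B)
    (hf : Function.Injective f.toFun) : A.IsLocallyFinite := by
  intro s hs
  refine ((hB _ (hs.image f.toFun)).preimage hf.injOn).subset fun a ha => ?_
  exact ha ((Subalg.closure (f.toFun '' s)).comap f) fun b hb =>
    Subalg.subset_closure _ (mem_image_of_mem _ hb)

theorem IsLocallyFinite.of_surjective (hA : A.IsLocallyFinite) (f : A.Hom B)
    (hf : Function.Surjective f.toFun) : B.IsLocallyFinite := by
  intro s hs
  obtain ⟨g, hg⟩ := hf.hasRightInverse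
  refine ((hA _ (hs.image g)).image f.toFun).subset fun b hb => ?_
  exact hb ((Subalg.closure (g '' s)).map f) fun c hc =>
    ⟨g c, Subalg.subset_closure _ (mem_image_of_mem _ hc), hg c⟩

end Alg

/-! ### Representation of the members of `HSP(K)` -/

variable {K : Set Alg.{u}}

/-- Membership in `HSP(K)`: the algebra is a homomorphic image of an algebra whose points are
separated by homomorphisms to members of `K`. -/
theorem mem_HSP_iff {B : Alg.{u}} : B ∈ opH (opS (opP K)) ↔
    ∃ (C : Alg.{u}) (ι : Type u) (A : ι → Alg.{u}) (g : ∀ i, C.Hom (A i)) (f : C.Hom B),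
      (∀ i, A i ∈ K) ∧ (∀ x y, (∀ i, (g i).toFun x = (g i).toFun y) → x = y) ∧
      Function.Surjective f.toFun := by
  constructor
  · rintro ⟨C, ⟨D, ⟨ι, A, hA, p, hp⟩, j, hj⟩, f, hf⟩
    exact ⟨C, ι, A, fun i => (Alg.Hom.eval A i).comp (p.comp j), f, hA,
      fun x y h => hj (hp.1 (funext h)), hf⟩
  · rintro ⟨C, ι, A, g, f, hA, hg, hf⟩
    exact ⟨C, ⟨Alg.prod A, ⟨ι, A, hA, Alg.Hom.id _, Function.bijective_id⟩, Alg.Hom.pi g,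
      fun x y h => hg x y fun i => congrFun h i⟩, f, hf⟩

theorem mem_HSP_of_forall_mem {ι : Type u} {A : ι → Alg.{u}} (hA : ∀ i, A i ∈ K) :
    Alg.prod A ∈ opH (opS (opP K)) :=
  mem_HSP_iff.2 ⟨_, ι, A, Alg.Hom.eval A, Alg.Hom.id _, hA, fun _ _ h => funext h,
    Function.surjective_id⟩

theorem isVariety_HSP (K : Set Alg.{u}) : IsVariety (opH (opS (opP K))) where
  opH_subset := by
    rintro B ⟨A, hA, h, hh⟩
    obtain ⟨C, ι, D, g, f, hD, hg, hf⟩ := mem_HSP_iff.1 hA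
    exact mem_HSP_iff.2 ⟨C, ι, D, g, h.comp f, hD, hg, hh.comp hf⟩
  opS_subset := by
    rintro B ⟨A, hA, j, hj⟩
    obtain ⟨C, ι, D, g, f, hD, hg, hf⟩ := mem_HSP_iff.1 hA
    -- The preimage of the subalgebra `B` of `A` under `C → A` maps onto `B`.
    let S : C.Subalg := (Alg.Subalg.range j).comap f
    have hr : ∀ c : S.toAlg, ∃ b, j.toFun b = (f.comp S.incl).toFun c := fun c => c.2
    refine mem_HSP_iff.2 ⟨S.toAlg, ι, D, fun i => (g i).comp S.incl,
      Alg.Hom.lift j hj (f.comp S.incl) hr, hD, fun x y h => Subtype.ext (hg _ _ h), fun b => ?_⟩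
    obtain ⟨c, hc⟩ := hf (j.toFun b)
    exact ⟨⟨c, b, hc.symm⟩, hj ((Alg.Hom.lift_spec j hj _ hr _).trans hc)⟩
  opP_subset := by
    rintro B ⟨ι, A, hA, p, hp⟩
    choose C κ D g f hD hg hf using fun i => mem_HSP_iff.1 (hA i)
    let q : (Alg.prod C).Hom (Alg.prod A) :=
      Alg.Hom.pi fun i => (f i).comp (Alg.Hom.eval C i)
    refine mem_HSP_iff.2 ⟨Alg.prod C, Σ i, κ i, fun k => D k.1 k.2,
      fun k => (g k.1 k.2).comp (Alg.Hom.eval C k.1),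
      Alg.Hom.lift p hp.1 q fun c => hp.2 (q.toFun c), fun k => hD k.1 k.2,
      fun x y h => funext fun i => hg i _ _ fun j => h ⟨i, j⟩, fun b => ?_⟩
    choose c hc using fun i => hf i (p.toFun b i)
    exact ⟨c, hp.1 ((Alg.Hom.lift_spec p hp.1 q _ _).trans (funext hc))⟩

/-! ### `MS4_S[n]` is closed under `HSP` -/

theorem mem_MS4SDepth_of_separated {n : ℕ} {C : Alg.{u}} {ι : Type u} {A : ι → Alg.{u}}
    (hA : ∀ i, A i ∈ MS4SDepth n) (g : ∀ i, C.Hom (A i))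
    (hg : ∀ x y, (∀ i, (g i).toFun x = (g i).toFun y) → x = y) : C ∈ MS4SDepth n := by
  have hle : ∀ x y, (∀ i, (g i).toFun x ≤ (g i).toFun y) → x ≤ y := fun x y h =>
    sup_eq_right.1 <| hg _ _ fun i => by rw [(g i).map_sup, sup_eq_right.2 (h i)]
  refine ⟨⟨⟨⟨?_, ?_, ?_, ?_⟩, ⟨⟨?_, ?_, ?_, ?_⟩, ?_⟩, ?_⟩, ?_⟩, ?_⟩
  · exact hg _ _ fun i => by simp only [Alg.Hom.map_dia₁, Alg.Hom.map_bot, (hA i).1.1.1.bot]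
  · exact fun a b => hg _ _ fun i => by
      simp only [Alg.Hom.map_dia₁, Alg.Hom.map_sup, (hA i).1.1.1.sup]
  · exact fun a => hle _ _ fun i => by
      simpa only [Alg.Hom.map_dia₁] using (hA i).1.1.1.le _
  · exact fun a => hle _ _ fun i => by
      simpa only [Alg.Hom.map_dia₁] using (hA i).1.1.1.idem _
  · exact hg _ _ fun i => by simp only [Alg.Hom.map_dia₂, Alg.Hom.map_bot, (hA i).1.1.2.1.bot]
  · exact fun a b => hg _ _ fun i => by
      simp only [Alg.Hom.map_dia₂, Alg.Hom.map_sup, (hA i).1.1.2.1.sup]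
  · exact fun a => hle _ _ fun i => by
      simpa only [Alg.Hom.map_dia₂] using (hA i).1.1.2.1.le _
  · exact fun a => hle _ _ fun i => by
      simpa only [Alg.Hom.map_dia₂] using (hA i).1.1.2.1.idem _
  · exact fun a => hle _ _ fun i => by
      simpa only [Alg.Hom.map_dia₂, Alg.Hom.map_compl] using (hA i).1.1.2.1.sym _
  · exact fun a => hle _ _ fun i => by
      simpa only [Alg.Hom.map_dia₁, Alg.Hom.map_dia₂] using (hA i).1.1.2.2 _
  · exact fun a => hle _ _ fun i => by
      simpa only [Alg.Hom.map_dia₁, Alg.Hom.map_dia₂, Alg.Hom.map_box₁, Alg.Hom.map_box₂] using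
        (hA i).1.2 _
  · exact fun q => hg _ _ fun i => by
      rw [Alg.Hom.map_depthTerm, (hA i).2, Alg.Hom.map_top]

theorem mem_MS4SDepth_of_surjective {n : ℕ} {C B : Alg.{u}} (hC : C ∈ MS4SDepth n) (f : C.Hom B)
    (hf : Function.Surjective f.toFun) : B ∈ MS4SDepth n := by
  refine ⟨⟨⟨⟨?_, ?_, ?_, ?_⟩, ⟨⟨?_, ?_, ?_, ?_⟩, ?_⟩, ?_⟩, ?_⟩, ?_⟩
  · rw [← f.map_bot, ← f.map_dia₁, hC.1.1.1.bot]
  · refine hf.forall₂.2 fun a b => ?_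
    rw [← f.map_sup, ← f.map_dia₁, hC.1.1.1.sup, f.map_sup, f.map_dia₁, f.map_dia₁]
  · refine hf.forall.2 fun a => ?_
    simpa only [f.map_dia₁] using f.mono (hC.1.1.1.le a)
  · refine hf.forall.2 fun a => ?_
    simpa only [f.map_dia₁] using f.mono (hC.1.1.1.idem a)
  · rw [← f.map_bot, ← f.map_dia₂, hC.1.1.2.1.bot]
  · refine hf.forall₂.2 fun a b => ?_
    rw [← f.map_sup, ← f.map_dia₂, hC.1.1.2.1.sup, f.map_sup, f.map_dia₂, f.map_dia₂]
  · refine hf.forall.2 fun a => ?_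
    simpa only [f.map_dia₂] using f.mono (hC.1.1.2.1.le a)
  · refine hf.forall.2 fun a => ?_
    simpa only [f.map_dia₂] using f.mono (hC.1.1.2.1.idem a)
  · refine hf.forall.2 fun a => ?_
    simpa only [f.map_dia₂, f.map_compl] using f.mono (hC.1.1.2.1.sym a)
  · refine hf.forall.2 fun a => ?_
    simpa only [f.map_dia₁, f.map_dia₂] using f.mono (hC.1.1.2.2 a)
  · refine hf.forall.2 fun a => ?_
    simpa only [f.map_dia₁, f.map_dia₂, f.map_box₁, f.map_box₂] using f.mono (hC.1.2 a)
  · intro q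
    choose r hr using fun k => hf (q k)
    obtain rfl : (fun k => f.toFun (r k)) = q := funext hr
    rw [← f.map_depthTerm, hC.2, f.map_top]

theorem HSP_subset_MS4SDepth {n : ℕ} (hK : K ⊆ MS4SDepth n) :
    opH (opS (opP K)) ⊆ MS4SDepth n := by
  intro B hB
  obtain ⟨C, ι, A, g, f, hA, hg, hf⟩ := mem_HSP_iff.1 hB
  exact mem_MS4SDepth_of_surjective (mem_MS4SDepth_of_separated (fun i => hK (hA i)) g hg) f hf

/-! ### Quotient algebras and subdirect representation -/

namespace Alg

variable {A B : Alg.{u}}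

namespace Congruence

/-- The type of classes of a congruence. A type of its own, because Mathlib orders quotients of
ordered types by the image of the order. -/
def Classes (θ : A.Congruence) : Type u := Quotient θ.toSetoid

/-- The class of an element. -/
def cls (θ : A.Congruence) (a : A) : θ.Classes := Quotient.mk θ.toSetoid a

theorem cls_surjective (θ : A.Congruence) : Function.Surjective θ.cls := Quotient.mk_surjective

instance (θ : A.Congruence) : Max θ.Classes :=
  ⟨Quotient.map₂ (· ⊔ ·) fun _ _ h _ _ k => θ.sup h k⟩

instance (θ : A.Congruence) : Min θ.Classes :=
  ⟨Quotient.map₂ (· ⊓ ·) fun _ _ h _ _ k => θ.inf h k⟩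

instance (θ : A.Congruence) : Lattice θ.Classes :=
  Lattice.mk'
    (θ.cls_surjective.forall₂.2 fun a b => congrArg θ.cls (sup_comm a b))
    (θ.cls_surjective.forall₃.2 fun a b c => congrArg θ.cls (sup_assoc a b c))
    (θ.cls_surjective.forall₂.2 fun a b => congrArg θ.cls (inf_comm a b))
    (θ.cls_surjective.forall₃.2 fun a b c => congrArg θ.cls (inf_assoc a b c))
    (θ.cls_surjective.forall₂.2 fun _ _ => congrArg θ.cls sup_inf_self)
    (θ.cls_surjective.forall₂.2 fun _ _ => congrArg θ.cls inf_sup_self)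

theorem cls_mono (θ : A.Congruence) {a b : A} (h : a ≤ b) : θ.cls a ≤ θ.cls b :=
  sup_eq_right.1 (congrArg θ.cls (sup_eq_right.2 h))

instance (θ : A.Congruence) : BooleanAlgebra θ.Classes where
  __ := DistribLattice.ofInfSupLe (α := θ.Classes)
    (θ.cls_surjective.forall₃.2 fun a b c => θ.cls_mono (inf_sup_left a b c).le)
  top := θ.cls ⊤
  bot := θ.cls ⊥
  compl := Quotient.map (fun a => aᶜ) fun _ _ h => θ.compl h
  le_top := θ.cls_surjective.forall.2 fun _ => θ.cls_mono le_top
  bot_le := θ.cls_surjective.forall.2 fun _ => θ.cls_mono bot_le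
  inf_compl_le_bot := θ.cls_surjective.forall.2 fun a => θ.cls_mono (inf_compl_self a).le
  top_le_sup_compl := θ.cls_surjective.forall.2 fun _ => θ.cls_mono sup_compl_eq_top.ge

/-- The quotient of an algebra by a congruence. -/
def quotient (θ : A.Congruence) : Alg.{u} where
  carrier := θ.Classes
  dia₁ := Quotient.map A.dia₁ fun _ _ h => θ.dia₁ h
  dia₂ := Quotient.map A.dia₂ fun _ _ h => θ.dia₂ h

/-- The projection onto a quotient algebra. -/
def proj (θ : A.Congruence) : A.Hom θ.quotient :=
  Hom.ofSupCompl (B := θ.quotient) θ.cls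
    (fun _ _ => rfl) (fun _ => rfl) (fun _ => rfl) (fun _ => rfl)

theorem proj_surjective (θ : A.Congruence) : Function.Surjective θ.proj.toFun :=
  θ.cls_surjective

theorem proj_eq_iff (θ : A.Congruence) {a b : A} :
    θ.proj.toFun a = θ.proj.toFun b ↔ θ.r a b :=
  ⟨fun h => Quotient.exact (s := θ.toSetoid) h, fun h => Quotient.sound (s := θ.toSetoid) h⟩

/-- The preimage of a congruence under a homomorphism. -/
def comap (f : A.Hom B) (θ : B.Congruence) : A.Congruence where
  r a b := θ.r (f.toFun a) (f.toFun b)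
  iseqv := ⟨fun _ => θ.iseqv.refl _, fun h => θ.iseqv.symm h, fun h k => θ.iseqv.trans h k⟩
  sup h k := by simpa only [f.map_sup] using θ.sup h k
  inf h k := by simpa only [f.map_inf] using θ.inf h k
  compl h := by simpa only [f.map_compl] using θ.compl h
  dia₁ h := by simpa only [f.map_dia₁] using θ.dia₁ h
  dia₂ h := by simpa only [f.map_dia₂] using θ.dia₂ h

/-- The congruence generated by a pair. -/
def principal (a b : A) : A.Congruence where
  r x y := ∀ θ : A.Congruence, θ.r a b → θ.r x y
  iseqv := ⟨fun _ θ _ => θ.iseqv.refl _, fun h θ hθ => θ.iseqv.symm (h θ hθ),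
    fun h k θ hθ => θ.iseqv.trans (h θ hθ) (k θ hθ)⟩
  sup h k θ hθ := θ.sup (h θ hθ) (k θ hθ)
  inf h k θ hθ := θ.inf (h θ hθ) (k θ hθ)
  compl h θ hθ := θ.compl (h θ hθ)
  dia₁ h θ hθ := θ.dia₁ (h θ hθ)
  dia₂ h θ hθ := θ.dia₂ (h θ hθ)

/-- The identity congruence. -/
def identity (A : Alg.{u}) : A.Congruence where
  r x y := x = y
  iseqv := ⟨fun _ => rfl, fun h => h.symm, fun h k => h.trans k⟩
  sup h k := by rw [h, k]
  inf h k := by rw [h, k]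
  compl h := by rw [h]
  dia₁ h := by rw [h]
  dia₂ h := by rw [h]

/-- The union of a nonempty chain of congruences. -/
def chainUnion (c : Set A.Congruence) (hne : c.Nonempty)
    (hc : ∀ θ ∈ c, ∀ ψ ∈ c, ∃ χ ∈ c, (∀ x y, θ.r x y → χ.r x y) ∧ ∀ x y, ψ.r x y → χ.r x y) :
    A.Congruence where
  r x y := ∃ θ ∈ c, θ.r x y
  iseqv := ⟨fun _ => hne.elim fun θ h => ⟨θ, h, θ.iseqv.refl _⟩,
    fun ⟨θ, h, k⟩ => ⟨θ, h, θ.iseqv.symm k⟩, fun ⟨θ, h, k⟩ ⟨ψ, h', k'⟩ =>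
      let ⟨χ, hχ, l, l'⟩ := hc θ h ψ h'
      ⟨χ, hχ, χ.iseqv.trans (l _ _ k) (l' _ _ k')⟩⟩
  sup := fun ⟨θ, h, k⟩ ⟨ψ, h', k'⟩ =>
    let ⟨χ, hχ, l, l'⟩ := hc θ h ψ h'
    ⟨χ, hχ, χ.sup (l _ _ k) (l' _ _ k')⟩
  inf := fun ⟨θ, h, k⟩ ⟨ψ, h', k'⟩ =>
    let ⟨χ, hχ, l, l'⟩ := hc θ h ψ h'
    ⟨χ, hχ, χ.inf (l _ _ k) (l' _ _ k')⟩
  compl := fun ⟨θ, h, k⟩ => ⟨θ, h, θ.compl k⟩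
  dia₁ := fun ⟨θ, h, k⟩ => ⟨θ, h, θ.dia₁ k⟩
  dia₂ := fun ⟨θ, h, k⟩ => ⟨θ, h, θ.dia₂ k⟩

theorem exists_maximal_not_rel {a b : A} (hab : a ≠ b) :
    ∃ θ : A.Congruence, ¬ θ.r a b ∧
      ∀ ψ : A.Congruence, (∀ x y, θ.r x y → ψ.r x y) → ¬ ψ.r a b → ∀ x y, ψ.r x y → θ.r x y := by
  let P := {θ : A.Congruence // ¬ θ.r a b}
  let le : P → P → Prop := fun θ ψ => ∀ x y, θ.1.r x y → ψ.1.r x y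
  have : Nonempty P := ⟨⟨identity A, hab⟩⟩
  obtain ⟨⟨θ, hθ⟩, hmax⟩ := exists_maximal_of_nonempty_chains_bounded (r := le)
    (fun c hc hne => by
      let U := chainUnion (Subtype.val '' c) (hne.image _) (by
        rintro _ ⟨θ, hθ, rfl⟩ _ ⟨ψ, hψ, rfl⟩
        by_cases e : θ = ψ
        · exact ⟨θ.1, ⟨θ, hθ, rfl⟩, fun _ _ h => h, fun _ _ h => e ▸ h⟩
        · rcases hc hθ hψ e with h | h
          · exact ⟨ψ.1, ⟨ψ, hψ, rfl⟩, h, fun _ _ h => h⟩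
          · exact ⟨θ.1, ⟨θ, hθ, rfl⟩, fun _ _ h => h, h⟩)
      refine ⟨⟨U, ?_⟩, fun θ hθ x y h => ⟨θ.1, ⟨θ, hθ, rfl⟩, h⟩⟩
      rintro ⟨_, ⟨θ, _, rfl⟩, h⟩
      exact θ.2 h)
    (fun h k x y hxy => k x y (h x y hxy))
  exact ⟨θ, hθ, fun ψ hψ hab => hmax ⟨ψ, hab⟩ hψ⟩

end Congruence

/-- The quotient by a congruence that is maximal among those separating `a` from `b` is
subdirectly irreducible: its least nontrivial congruence is generated by the images of `a`
and `b`. -/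
theorem exists_subdirectlyIrreducible_separating {a b : A} (hab : a ≠ b) :
    ∃ (B : Alg.{u}) (f : A.Hom B), Function.Surjective f.toFun ∧ B.IsSubdirectlyIrreducible ∧
      f.toFun a ≠ f.toFun b := by
  obtain ⟨θ, hθ, hmax⟩ := Congruence.exists_maximal_not_rel hab
  have hne : θ.proj.toFun a ≠ θ.proj.toFun b := fun h => hθ (θ.proj_eq_iff.1 h)
  refine ⟨θ.quotient, θ.proj, θ.proj_surjective,
    ⟨Congruence.principal (θ.proj.toFun a) (θ.proj.toFun b), ⟨_, _, fun _ h => h, hne⟩, ?_⟩, hne⟩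
  rintro ψ ⟨x, y, hxy, hne'⟩ z w hzw
  refine hzw ψ ?_
  by_contra hcon
  obtain ⟨x, rfl⟩ := θ.proj_surjective x
  obtain ⟨y, rfl⟩ := θ.proj_surjective y
  refine hne' (θ.proj_eq_iff.2 (hmax (ψ.comap θ.proj) (fun u v h => ?_) hcon x y hxy))
  change ψ.r _ _
  rw [θ.proj_eq_iff.2 h]

/-- Birkhoff's subdirect representation: the subdirectly irreducible homomorphic images of an
algebra separate its points. -/
theorem exists_subdirect_representation (A : Alg.{u}) :
    ∃ (ι : Type u) (B : ι → Alg.{u}) (f : ∀ i, A.Hom (B i)),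
      (∀ i, Function.Surjective (f i).toFun) ∧ (∀ i, (B i).IsSubdirectlyIrreducible) ∧
      ∀ x y, (∀ i, (f i).toFun x = (f i).toFun y) → x = y := by
  choose B f hf hB hne using
    fun p : {p : A × A // p.1 ≠ p.2} => exists_subdirectlyIrreducible_separating p.2
  refine ⟨_, B, f, hf, hB, fun x y h => ?_⟩
  by_contra hxy
  exact hne ⟨(x, y), hxy⟩ (h _)

end Alg

/-! ### Common fixpoints in subdirectly irreducible `S5₂`-algebras -/

theorem IsS5Op.map_inf_fix {B : Type u} [BooleanAlgebra B] {d : B → B} (h : IsS5Op d) {z : B}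
    (hz : d z = z) (a : B) : d a ⊓ z = d (a ⊓ z) := by
  refine le_antisymm ?_ (le_inf (h.toIsS4Op.mono inf_le_left)
    ((h.toIsS4Op.mono inf_le_right).trans_eq hz))
  have h1 : a ≤ (a ⊓ z) ⊔ zᶜ := by
    rw [sup_inf_right, sup_compl_eq_top, inf_top_eq]; exact le_sup_left
  have h2 : d a ≤ d (a ⊓ z) ⊔ zᶜ := by
    have := h.toIsS4Op.mono h1
    rwa [h.sup, h.fix_compl hz] at this
  calc d a ⊓ z ≤ (d (a ⊓ z) ⊔ zᶜ) ⊓ z := inf_le_inf_right _ h2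
    _ = d (a ⊓ z) ⊓ z := by rw [inf_sup_right, compl_inf_self, sup_bot_eq]
    _ ≤ d (a ⊓ z) := inf_le_left

/-- The congruence of equality below a common fixpoint of the two operators. -/
def congruenceBelow {A : Alg.{u}} (hA : A ∈ S52) {z : A} (h₁ : A.dia₁ z = z)
    (h₂ : A.dia₂ z = z) : A.Congruence where
  r a b := a ⊓ z = b ⊓ z
  iseqv := ⟨fun _ => rfl, fun h => h.symm, fun h k => h.trans k⟩
  sup h k := by rw [inf_sup_right, inf_sup_right, h, k]
  inf h k := by rw [inf_inf_distrib_right, h, k, ← inf_inf_distrib_right]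
  compl {a b} h := by
    have key : ∀ a : A, aᶜ ⊓ z = (a ⊓ z)ᶜ ⊓ z := fun a => by
      rw [compl_inf, inf_sup_right, compl_inf_self, sup_bot_eq]
    rw [key, h, ← key]
  dia₁ h := by rw [hA.1.map_inf_fix h₁, h, ← hA.1.map_inf_fix h₁]
  dia₂ h := by rw [hA.2.map_inf_fix h₂, h, ← hA.2.map_inf_fix h₂]

/-- A common fixpoint `z` splits the algebra as the product of the parts below `z` and below `zᶜ`,
so one of the two parts is trivial if the algebra is subdirectly irreducible. -/
theorem Alg.IsSubdirectlyIrreducible.eq_bot_or_eq_top {A : Alg.{u}}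
    (hsi : A.IsSubdirectlyIrreducible) (hA : A ∈ S52) {z : A} (h₁ : A.dia₁ z = z)
    (h₂ : A.dia₂ z = z) : z = ⊥ ∨ z = ⊤ := by
  by_contra! hcon
  obtain ⟨μ, ⟨a, b, hab, hne⟩, hμ⟩ := hsi
  have k₁ : a ⊓ z = b ⊓ z := hμ (congruenceBelow hA h₁ h₂)
    ⟨zᶜ, ⊥, show zᶜ ⊓ z = ⊥ ⊓ z by simp, fun e => hcon.2 (compl_eq_bot.1 e)⟩ a b hab
  have k₂ : a ⊓ zᶜ = b ⊓ zᶜ := hμ (congruenceBelow hA (hA.1.fix_compl h₁) (hA.2.fix_compl h₂))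
    ⟨z, ⊥, show z ⊓ zᶜ = ⊥ ⊓ zᶜ by simp, hcon.1⟩ a b hab
  exact hne (by
    rw [← inf_top_eq a, ← sup_compl_eq_top (x := z), inf_sup_left, k₁, k₂, ← inf_sup_left,
      sup_compl_eq_top, inf_top_eq])

/-! ### Stone duality -/

namespace Uf

variable {B : Type u} [BooleanAlgebra B]

theorem exists_mem_of_ne_bot {a : B} (ha : a ≠ ⊥) : ∃ x : Uf B, a ∈ x.carrier := by
  have hdis : Disjoint ((Order.PFilter.principal a : Order.PFilter B) : Set B)
      ((Order.Ideal.principal (⊥ : B) : Order.Ideal B) : Set B) := by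
    rw [Set.disjoint_left]
    intro b hb hb'
    exact ha (le_bot_iff.1 (le_trans (Order.PFilter.mem_principal.1 hb)
      (Order.Ideal.mem_principal.1 hb')))
  obtain ⟨J, hJ, -, hd⟩ := DistribLattice.prime_ideal_of_disjoint_filter_ideal hdis
  have haJ : a ∉ J := Set.disjoint_left.1 hd (Order.PFilter.mem_principal.2 le_rfl)
  have htop : (⊤ : B) ∉ J := fun h => haJ (J.lower le_top h)
  exact ⟨{ carrier := {b | b ∉ J}
           top_mem := htop
           inf_mem := fun hb hc hbc => (hJ.mem_or_mem hbc).elim hb hc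
           mem_of_le := fun hbc hb hc => hb (J.lower hbc hc)
           compl_mem_iff := fun {b} => by
            simp only [Set.mem_ofPred_eq, not_not]
            constructor
            · intro hb
              exact (hJ.mem_or_compl_mem (x := b)).resolve_right hb
            · intro hb hb'
              exact htop (by simpa using Order.Ideal.sup_mem hb hb') }, haJ⟩

theorem basic_bot : basic (⊥ : B) = ∅ := by
  refine Set.eq_empty_of_forall_notMem fun x hx => ?_
  have h : (⊤ : B)ᶜ ∈ x.carrier := by rwa [compl_top]
  exact x.compl_mem_iff.1 h x.top_mem

theorem basic_top : basic (⊤ : B) = univ := by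
  rw [← compl_bot, ← basic_compl, basic_bot, compl_empty]

theorem basic_sup (a b : B) : basic (a ⊔ b) = basic a ∪ basic b := by
  rw [← compl_compl (a ⊔ b), compl_sup, ← basic_compl, basic_inf, ← basic_compl, ← basic_compl,
    compl_inter, compl_compl, compl_compl]

theorem basic_eq_empty_iff {a : B} : basic a = ∅ ↔ a = ⊥ := by
  refine ⟨fun h => ?_, fun h => h ▸ basic_bot⟩
  by_contra ha
  obtain ⟨x, hx⟩ := exists_mem_of_ne_bot ha
  exact (Set.ext_iff.1 h x).1 hx

theorem basic_injective : Function.Injective (basic (B := B)) := by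
  have key : ∀ a b : B, basic a ⊆ basic b → a ≤ b := fun a b h => by
    rw [← disjoint_compl_right_iff, disjoint_iff, ← basic_eq_empty_iff, basic_inf, ← basic_compl]
    exact Set.eq_empty_of_forall_notMem fun x hx => hx.2 (h hx.1)
  exact fun a b h => le_antisymm (key a b h.subset) (key b a h.superset)

theorem exists_eq_basic {U : Set (Uf B)} (hU : IsClopen U) : ∃ a : B, U = basic a := by
  obtain ⟨s, hs, rfl⟩ := eq_finite_iUnion_of_isTopologicalBasis_of_isCompact_open
    (basic (B := B)) isTopologicalBasis U hU.isClosed.isCompact hU.isOpen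
  induction s, hs using Set.Finite.induction_on with
  | empty => exact ⟨⊥, by rw [basic_bot]; simp⟩
  | insert _ hs ih =>
    obtain ⟨b, hb⟩ := ih (hs.isClopen_biUnion fun a _ => isClopen_basic a)
    exact ⟨_ ⊔ b, by rw [biUnion_insert, hb, basic_sup]⟩

end Uf

/-! ### The algebra of the top-rail frame has depth two -/

namespace Frame

variable {F : Frame.{u}} {U : F.dual} {p : F}

theorem mem_dia₁ : p ∈ F.dual.dia₁ U ↔ ∃ q ∈ U, F.rel₁ p q := Iff.rfl

theorem mem_dia₂ : p ∈ F.dual.dia₂ U ↔ ∃ q ∈ U, F.rel₂ p q := Iff.rfl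

theorem mem_compl : p ∈ Uᶜ ↔ p ∉ U := Iff.rfl

theorem mem_box₁ : p ∈ F.dual.box₁ U ↔ ∀ q, F.rel₁ p q → q ∈ U := by
  rw [Alg.box₁, mem_compl, mem_dia₁]
  simp only [not_exists, not_and]
  exact forall_congr' fun q => not_imp_not.trans Iff.rfl

theorem mem_box₂ : p ∈ F.dual.box₂ U ↔ ∀ q, F.rel₂ p q → q ∈ U := by
  rw [Alg.box₂, mem_compl, mem_dia₂]
  simp only [not_exists, not_and]
  exact forall_congr' fun q => not_imp_not.trans Iff.rfl

theorem dual_isS4Op₁ (refl : ∀ x, F.rel₁ x x)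
    (trans : ∀ {x y z}, F.rel₁ x y → F.rel₁ y z → F.rel₁ x z) : IsS4Op F.dual.dia₁ where
  bot := Clopens.ext (Set.ext fun _ => ⟨fun ⟨_, h, _⟩ => h.elim, fun h => h.elim⟩)
  sup _ _ := Clopens.ext <| Set.ext fun _ =>
    ⟨fun ⟨q, h, r⟩ => h.imp (fun h => ⟨q, h, r⟩) fun h => ⟨q, h, r⟩,
      fun h => h.elim (fun ⟨q, h, r⟩ => ⟨q, .inl h, r⟩) fun ⟨q, h, r⟩ => ⟨q, .inr h, r⟩⟩
  le _ p h := ⟨p, h, refl p⟩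
  idem := fun _ _ ⟨_, ⟨q, h, r⟩, r'⟩ => ⟨q, h, trans r' r⟩

theorem dual_isS5Op₂ (equiv : Equivalence F.rel₂) : IsS5Op F.dual.dia₂ where
  bot := Clopens.ext (Set.ext fun _ => ⟨fun ⟨_, h, _⟩ => h.elim, fun h => h.elim⟩)
  sup _ _ := Clopens.ext <| Set.ext fun _ =>
    ⟨fun ⟨q, h, r⟩ => h.imp (fun h => ⟨q, h, r⟩) fun h => ⟨q, h, r⟩,
      fun h => h.elim (fun ⟨q, h, r⟩ => ⟨q, .inl h, r⟩) fun ⟨q, h, r⟩ => ⟨q, .inr h, r⟩⟩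
  le _ p h := ⟨p, h, equiv.refl p⟩
  idem := fun _ _ ⟨_, ⟨q, h, r⟩, r'⟩ => ⟨q, h, equiv.trans r' r⟩
  sym := fun _ _ ⟨_, h, r⟩ ⟨q, hq, r'⟩ => h ⟨q, hq, equiv.trans (equiv.symm r) r'⟩

end Frame

theorem MS4Frame.dual_mem_MS4 (F : MS4Frame.{u}) : F.toFrame.dual ∈ MS4 := by
  refine ⟨F.dual_isS4Op₁ F.refl₁ F.trans₁, F.dual_isS5Op₂ F.equiv₂, ?_⟩
  rintro U p ⟨q, ⟨r, hr, hqr⟩, hpq⟩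
  obtain ⟨s, hs, hsr⟩ := F.comm hpq hqr
  exact ⟨s, ⟨r, hr, hsr⟩, hs⟩

namespace S52Frame

variable (F : S52Frame.{u})

theorem topRail_dual_mem_MS4SDepth : F.topRail.toFrame.dual ∈ MS4SDepth 2 := by
  refine ⟨⟨F.topRail.dual_mem_MS4, fun U => ?_⟩, fun q => ?_⟩
  · -- Every point sees the whole rail, and every point is `E`-related to a point of the rail, so
    -- `□∀U` is nonempty only for `U = ⊤`.
    rintro p ⟨q, ⟨r, hr, -⟩, -⟩
    have hU : ∀ s, s ∈ U := fun s => by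
      refine Frame.mem_box₂.1 (Frame.mem_box₁.1 hr (.inr (F.toRail s)) ?_) s
        ((F.railE_iff _ _).2 rfl)
      cases r <;> trivial
    exact Frame.mem_box₁.2 fun t _ => Frame.mem_box₂.2 fun s _ => hU s
  · change F.topRail.toFrame.dual.dia₁ (F.topRail.toFrame.dual.box₁ (q 2) ⊓
      (F.topRail.toFrame.dual.dia₁ (F.topRail.toFrame.dual.box₁ (q 1) ⊓ ⊥ᶜ) ⇨
        F.topRail.toFrame.dual.box₁ (q 1))ᶜ) ⇨ F.topRail.toFrame.dual.box₁ (q 2) = ⊤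
    rw [himp_eq_top_iff, compl_himp]
    rintro p ⟨r, ⟨hr, ⟨s, ⟨hs, -⟩, hrs⟩, hr'⟩, hpr⟩
    rcases r with x | α
    · rcases p with y | β
      · exact Frame.mem_box₁.2 fun t ht =>
          Frame.mem_box₁.1 hr t (F.topRail.trans₁ (F.topRail.refl₁ _) (by
            rcases t with t | t
            · exact F.equiv₁.trans (F.equiv₁.symm hpr) ht
            · trivial))
      · exact hpr.elim
    · -- At a point of the rail, `◇□q → □q` holds, because the rail is a final cluster.
      rcases s with x | β
      · exact hrs.elim
      · refine (hr' (Frame.mem_box₁.2 fun t ht => Frame.mem_box₁.1 hs t ?_)).elim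
        cases t
        · exact ht.elim
        · trivial

end S52Frame

/-! ### Elements of the top-rail algebra as pairs -/

section Codes

variable {A : Alg.{u}} {hA : A ∈ S52} {a b v w : A} {U W : translateAlg A hA}

/-- The clopen set `U` of the top-rail frame of `A` is coded by the pair `(a, w)`: its part in the
space of ultrafilters is given by `a`, and the preimage of its part in the rail is given by `w`. -/
def Codes (a w : A) (U : translateAlg A hA) : Prop :=
  (∀ x : Uf A, (Sum.inl x : (dualFrame A hA).Total) ∈ U ↔ x ∈ Uf.basic a) ∧
    ∀ x : Uf A, (Sum.inr (Quotient.mk _ x) : (dualFrame A hA).Total) ∈ U ↔ x ∈ Uf.basic w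

theorem exists_codes (U : translateAlg A hA) : ∃ a w, Codes a w U := by
  have hU := ((dualFrame A hA).isClopen_sum_iff _).1 U.isClopen
  obtain ⟨a, ha⟩ := Uf.exists_eq_basic hU.1
  obtain ⟨w, hw⟩ := Uf.exists_eq_basic (((dualFrame A hA).isClopen_quot_iff _).1 hU.2)
  exact ⟨a, w, Set.ext_iff.1 ha, Set.ext_iff.1 hw⟩

theorem Codes.unique (h : Codes a w U) (k : Codes a w W) : U = W := by
  refine Clopens.ext (Set.ext ?_)
  rintro (x | α)
  · exact (h.1 x).trans (k.1 x).symm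
  · induction α using Quotient.inductionOn with
    | _ x => exact (h.2 x).trans (k.2 x).symm

theorem Codes.fst_eq (h : Codes a w U) (k : Codes b v U) : a = b :=
  Uf.basic_injective (Set.ext fun x => (h.1 x).symm.trans (k.1 x))

theorem codes_bot : Codes ⊥ ⊥ (⊥ : translateAlg A hA) := by
  constructor <;> intro x <;> rw [Uf.basic_bot] <;> exact Iff.rfl

theorem Codes.sup (h : Codes a w U) (k : Codes b v W) : Codes (a ⊔ b) (w ⊔ v) (U ⊔ W) := by
  constructor <;> intro x <;> rw [Uf.basic_sup]
  · exact or_congr (h.1 x) (k.1 x)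
  · exact or_congr (h.2 x) (k.2 x)

theorem Codes.inf (h : Codes a w U) (k : Codes b v W) : Codes (a ⊓ b) (w ⊓ v) (U ⊓ W) := by
  constructor <;> intro x <;> rw [Uf.basic_inf]
  · exact and_congr (h.1 x) (k.1 x)
  · exact and_congr (h.2 x) (k.2 x)

theorem Codes.compl (h : Codes a w U) : Codes aᶜ wᶜ Uᶜ := by
  constructor <;> intro x <;> rw [← Uf.basic_compl]
  · exact not_congr (h.1 x)
  · exact not_congr (h.2 x)

theorem Codes.dia₂ (h : Codes a w U) :
    Codes (A.dia₂ a ⊔ w) (A.dia₂ a ⊔ w) ((translateAlg A hA).dia₂ U) := by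
  have key : ∀ (x : Uf A) (p : (dualFrame A hA).Total),
      (dualFrame A hA).toRail p = Quotient.mk _ x →
      (p ∈ (translateAlg A hA).dia₂ U ↔ x ∈ Uf.basic (A.dia₂ a ⊔ w)) := by
    intro x p hp
    rw [Frame.mem_dia₂, Uf.basic_sup, ← relPre_basic hA.2]
    constructor
    · rintro ⟨y | β, hq, hpq⟩
      · have e := hp.symm.trans (((dualFrame A hA).railE_iff _ _).1 hpq)
        exact Or.inl ⟨y, (h.1 y).1 hq, Quotient.exact (s := (dualFrame A hA).setoid₂) e⟩
      · have e := hp.symm.trans (((dualFrame A hA).railE_iff _ _).1 hpq)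
        refine Or.inr ((h.2 x).1 ?_)
        change Quotient.mk _ x = β at e
        rwa [e]
    · rintro (⟨y, hy, hxy⟩ | hx)
      · exact ⟨.inl y, (h.1 y).2 hy, ((dualFrame A hA).railE_iff _ _).2
          (hp.trans (Quotient.sound (s := (dualFrame A hA).setoid₂) hxy))⟩
      · exact ⟨.inr (Quotient.mk _ x), (h.2 x).2 hx, ((dualFrame A hA).railE_iff _ _).2 hp⟩
  exact ⟨fun x => key x _ rfl, fun x => key x _ rfl⟩

theorem Codes.dia₁_of_eq_bot (h : Codes a ⊥ U) :
    Codes (A.dia₁ a) ⊥ ((translateAlg A hA).dia₁ U) := by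
  have hrail : ∀ β : (dualFrame A hA).Rail, (Sum.inr β : (dualFrame A hA).Total) ∉ U := by
    intro β hβ
    induction β using Quotient.inductionOn with
    | _ x =>
      have := (h.2 x).1 hβ
      rwa [Uf.basic_bot] at this
  constructor <;> intro x
  · rw [Frame.mem_dia₁, ← relPre_basic hA.1]
    constructor
    · rintro ⟨y | β, hq, hpq⟩
      · exact ⟨y, (h.1 y).1 hq, hpq⟩
      · exact (hrail β hq).elim
    · rintro ⟨y, hy, hxy⟩
      exact ⟨.inl y, (h.1 y).2 hy, hxy⟩
  · rw [Frame.mem_dia₁, Uf.basic_bot]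
    constructor
    · rintro ⟨y | β, hq, hpq⟩
      · exact hpq.elim
      · exact (hrail β hq).elim
    · exact fun h => h.elim

theorem Codes.dia₁_of_ne_bot (h : Codes a w U) (hw : w ≠ ⊥) :
    Codes ⊤ ⊤ ((translateAlg A hA).dia₁ U) := by
  obtain ⟨y, hy⟩ := Uf.exists_mem_of_ne_bot hw
  constructor <;> intro x <;> rw [Frame.mem_dia₁, Uf.basic_top] <;>
    exact ⟨fun _ => trivial, fun _ => ⟨.inr (Quotient.mk _ y), (h.2 y).2 hy, trivial⟩⟩

/-- The element `a` of `A` as a clopen set of the top-rail frame that misses the rail. -/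
def bodyClopen (hA : A ∈ S52) (a : A) : translateAlg A hA :=
  ⟨Sum.inl '' Uf.basic a, by
    refine ((dualFrame A hA).isClopen_sum_iff _).2 ⟨?_, ?_⟩
    · rw [Set.preimage_image_eq _ Sum.inl_injective]
      exact Uf.isClopen_basic a
    · convert isClopen_empty
      ext
      simp⟩

theorem codes_bodyClopen (hA : A ∈ S52) (a : A) : Codes a ⊥ (bodyClopen hA a) := by
  constructor <;> intro x
  · exact Sum.inl_injective.mem_set_image
  · rw [Uf.basic_bot]
    exact ⟨fun ⟨_, _, e⟩ => (Sum.inl_ne_inr e).elim, fun h => h.elim⟩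

theorem bodyClopen_injective (hA : A ∈ S52) : Function.Injective (bodyClopen hA) := fun a b h =>
  (codes_bodyClopen hA a).fst_eq (h ▸ codes_bodyClopen hA b)

theorem bodyClopen_bot : bodyClopen hA ⊥ = ⊥ := (codes_bodyClopen hA ⊥).unique codes_bot

theorem bodyClopen_sup : bodyClopen hA (a ⊔ b) = bodyClopen hA a ⊔ bodyClopen hA b := by
  refine (codes_bodyClopen hA _).unique ?_
  simpa using (codes_bodyClopen hA a).sup (codes_bodyClopen hA b)

/-- The algebra `A` is the relativization of its top-rail algebra to the element `bodyClopen hA ⊤`: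
this and the next two lemmas express its operations by those of the top-rail algebra. -/
theorem bodyClopen_compl : bodyClopen hA aᶜ = (bodyClopen hA a)ᶜ ⊓ bodyClopen hA ⊤ := by
  refine (codes_bodyClopen hA _).unique ?_
  simpa using (codes_bodyClopen hA a).compl.inf (codes_bodyClopen hA ⊤)

theorem bodyClopen_dia₁ : bodyClopen hA (A.dia₁ a) =
    (translateAlg A hA).dia₁ (bodyClopen hA a) ⊓ bodyClopen hA ⊤ := by
  refine (codes_bodyClopen hA _).unique ?_
  simpa using (codes_bodyClopen hA a).dia₁_of_eq_bot.inf (codes_bodyClopen hA ⊤)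

theorem bodyClopen_dia₂ : bodyClopen hA (A.dia₂ a) =
    (translateAlg A hA).dia₂ (bodyClopen hA a) ⊓ bodyClopen hA ⊤ := by
  refine (codes_bodyClopen hA _).unique ?_
  simpa using (codes_bodyClopen hA a).dia₂.inf (codes_bodyClopen hA ⊤)

end Codes

/-! ### Transfer of local finiteness -/

/-- Every element of a finite subalgebra lies below a common fixpoint of the two operators in the
subalgebra that vanishes in every coordinate in which the given element does. -/
theorem exists_common_fixpoint {ι : Type u} {A : ι → Alg.{u}} (hA : ∀ i, A i ∈ S52)
    (S : (Alg.prod A).Subalg) (hS : S.carrier.Finite) {w : ∀ i, A i} (hw : w ∈ S.carrier) :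
    ∃ z ∈ S.carrier, (Alg.prod A).dia₁ z = z ∧ (Alg.prod A).dia₂ z = z ∧ w ≤ z ∧
      ∀ i, w i = ⊥ → z i = ⊥ := by
  obtain ⟨z, ⟨hz, hwz, hbot⟩, hmax⟩ := Set.Finite.exists_maximal
    (s := {z | z ∈ S.carrier ∧ w ≤ z ∧ ∀ i, w i = ⊥ → z i = ⊥})
    (hS.subset fun _ h => h.1) ⟨w, hw, le_rfl, fun _ h => h⟩
  have le₁ : z ≤ (Alg.prod A).dia₁ z := fun i => (hA i).1.le _
  have le₂ : z ≤ (Alg.prod A).dia₂ z := fun i => (hA i).2.le _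
  refine ⟨z, hz, le_antisymm (hmax ⟨S.dia₁_mem _ hz, hwz.trans le₁, fun i hi => ?_⟩ le₁) le₁,
    le_antisymm (hmax ⟨S.dia₂_mem _ hz, hwz.trans le₂, fun i hi => ?_⟩ le₂) le₂, hwz, hbot⟩
  · change (A i).dia₁ (z i) = ⊥
    rw [hbot i hi, (hA i).1.bot]
  · change (A i).dia₂ (z i) = ⊥
    rw [hbot i hi, (hA i).2.bot]

/-- If a product of subdirectly irreducible algebras is locally finite, then so is the product of
their top-rail algebras: a finite subalgebra `S` of the first product containing the codes of the
generators gives the finite subalgebra of all elements with codes in `S`. -/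
theorem isLocallyFinite_prod_translateAlg {ι : Type u} {A : ι → Alg.{u}} (hA : ∀ i, A i ∈ S52)
    (hsi : ∀ i, (A i).IsSubdirectlyIrreducible) (hfin : (Alg.prod A).IsLocallyFinite) :
    (Alg.prod fun i => translateAlg (A i) (hA i)).IsLocallyFinite := by
  intro s hs
  choose a w haw using fun (U : Alg.prod fun i => translateAlg (A i) (hA i)) i => exists_codes (U i)
  let S : (Alg.prod A).Subalg := Alg.Subalg.closure (a '' s ∪ w '' s)
  have hS : S.carrier.Finite := hfin _ ((hs.image a).union (hs.image w))
  let P : (∀ i, A i) × (∀ i, A i) → (∀ i, translateAlg (A i) (hA i)) → Prop :=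
    fun p U => ∀ i, Codes (p.1 i) (p.2 i) (U i)
  let T : (Alg.prod fun i => translateAlg (A i) (hA i)).Subalg := Alg.Subalg.ofSupCompl
    {U | ∃ p ∈ S.carrier ×ˢ S.carrier, P p U}
    ⟨(⊥, ⊥), ⟨S.bot_mem, S.bot_mem⟩, fun i => codes_bot⟩
    (by
      rintro U ⟨p, hp, hU⟩ W ⟨q, hq, hW⟩
      exact ⟨(p.1 ⊔ q.1, p.2 ⊔ q.2), ⟨S.sup_mem hp.1 hq.1, S.sup_mem hp.2 hq.2⟩,
        fun i => (hU i).sup (hW i)⟩)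
    (by
      rintro U ⟨p, hp, hU⟩
      exact ⟨(p.1ᶜ, p.2ᶜ), ⟨S.compl_mem hp.1, S.compl_mem hp.2⟩, fun i => (hU i).compl⟩)
    (by
      rintro U ⟨p, hp, hU⟩
      -- By subdirect irreducibility, the common fixpoint `z` is `⊤` in the coordinates in which
      -- `U` meets the rail, and `⊥` in the others.
      obtain ⟨z, hz, hz₁, hz₂, hle, hbot⟩ := exists_common_fixpoint hA S hS hp.2
      refine ⟨((Alg.prod A).dia₁ p.1 ⊔ z, z), ⟨S.sup_mem (S.dia₁_mem _ hp.1) hz, hz⟩, fun i => ?_⟩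
      have hi := hU i
      change Codes ((A i).dia₁ (p.1 i) ⊔ z i) (z i) ((translateAlg (A i) (hA i)).dia₁ (U i))
      by_cases hw : p.2 i = ⊥
      · rw [hw] at hi
        rw [hbot i hw, sup_bot_eq]
        exact hi.dia₁_of_eq_bot
      · have htop : z i = ⊤ :=
          ((hsi i).eq_bot_or_eq_top (hA i) (congrFun hz₁ i) (congrFun hz₂ i)).resolve_left
            fun h => hw (le_bot_iff.1 (h ▸ hle i))
        rw [htop, sup_top_eq]
        exact hi.dia₁_of_ne_bot hw)
    (by
      rintro U ⟨p, hp, hU⟩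
      have h := S.sup_mem (S.dia₂_mem _ hp.1) hp.2
      exact ⟨(_, _), ⟨h, h⟩, fun i => (hU i).dia₂⟩)
  have hT : T.carrier.Finite := by
    refine Set.Finite.subset ((hS.prod hS).biUnion (t := fun p => {U | P p U}) fun p _ => ?_) ?_
    · exact Set.Subsingleton.finite fun U hU W hW => funext fun i => (hU i).unique (hW i)
    · rintro U ⟨p, hp, hU⟩
      exact mem_biUnion hp hU
  refine hT.subset fun U hU => hU T fun W hW => ?_
  exact ⟨(a W, w W), ⟨Alg.Subalg.subset_closure _ (.inl ⟨W, hW, rfl⟩),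
    Alg.Subalg.subset_closure _ (.inr ⟨W, hW, rfl⟩)⟩, fun i => haw W i⟩

/-- An algebra whose points are separated by homomorphisms to algebras `A i` is locally finite if
the product of the top-rail algebras of the `A i` is. -/
theorem isLocallyFinite_of_prod_translateAlg {ι : Type u} {A : ι → Alg.{u}}
    (hA : ∀ i, A i ∈ S52)
    (hfin : (Alg.prod fun i => translateAlg (A i) (hA i)).IsLocallyFinite) {B : Alg.{u}}
    (f : ∀ i, B.Hom (A i)) (hf : ∀ x y, (∀ i, (f i).toFun x = (f i).toFun y) → x = y) :
    B.IsLocallyFinite := by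
  intro s hs
  let e : B → Alg.prod fun i => translateAlg (A i) (hA i) :=
    fun b i => bodyClopen (hA i) ((f i).toFun b)
  have he : Function.Injective e := fun x y h =>
    hf x y fun i => bodyClopen_injective (hA i) (congrFun h i)
  let S : (Alg.prod fun i => translateAlg (A i) (hA i)).Subalg :=
    Alg.Subalg.closure (insert (e ⊤) (e '' s))
  have hS : S.carrier.Finite := hfin _ ((hs.image e).insert _)
  have htop : e ⊤ ∈ S.carrier := Alg.Subalg.subset_closure _ (mem_insert _ _)
  have he_top : ∀ i, e ⊤ i = bodyClopen (hA i) ⊤ := fun i => by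
    change bodyClopen (hA i) ((f i).toFun ⊤) = _
    rw [(f i).map_top]
  let T : B.Subalg := Alg.Subalg.ofSupCompl (e ⁻¹' S.carrier)
    (by
      have h : e ⊥ = ⊥ := funext fun i => by
        change bodyClopen (hA i) ((f i).toFun ⊥) = ⊥
        rw [(f i).map_bot, bodyClopen_bot]
      rw [mem_preimage, h]
      exact S.bot_mem)
    (by
      intro a ha b hb
      have h : e (a ⊔ b) = e a ⊔ e b := funext fun i => by
        change bodyClopen (hA i) ((f i).toFun (a ⊔ b)) = _
        rw [(f i).map_sup, bodyClopen_sup]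
        rfl
      rw [mem_preimage, h]
      exact S.sup_mem ha hb)
    (by
      intro a ha
      have h : e aᶜ = (e a)ᶜ ⊓ e ⊤ := funext fun i => by
        change bodyClopen (hA i) ((f i).toFun aᶜ) = (e a i)ᶜ ⊓ e ⊤ i
        rw [(f i).map_compl, bodyClopen_compl, he_top]
      rw [mem_preimage, h]
      exact S.inf_mem (S.compl_mem ha) htop)
    (by
      intro a ha
      have h : e (B.dia₁ a) = (Alg.prod fun i => translateAlg (A i) (hA i)).dia₁ (e a) ⊓ e ⊤ :=
        funext fun i => by
          change bodyClopen (hA i) ((f i).toFun (B.dia₁ a)) =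
            (translateAlg (A i) (hA i)).dia₁ (e a i) ⊓ e ⊤ i
          rw [(f i).map_dia₁, bodyClopen_dia₁, he_top]
      rw [mem_preimage, h]
      exact S.inf_mem (S.dia₁_mem _ ha) htop)
    (by
      intro a ha
      have h : e (B.dia₂ a) = (Alg.prod fun i => translateAlg (A i) (hA i)).dia₂ (e a) ⊓ e ⊤ :=
        funext fun i => by
          change bodyClopen (hA i) ((f i).toFun (B.dia₂ a)) =
            (translateAlg (A i) (hA i)).dia₂ (e a i) ⊓ e ⊤ i
          rw [(f i).map_dia₂, bodyClopen_dia₂, he_top]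
      rw [mem_preimage, h]
      exact S.inf_mem (S.dia₂_mem _ ha) htop)
  exact (hS.preimage he.injOn).subset fun b hb => hb T fun c hc =>
    Alg.Subalg.subset_closure _ (mem_insert_of_mem _ (mem_image_of_mem _ hc))

theorem translate_isLocallyFiniteClass {V : Set Alg.{u}} (hV : IsVariety V) (hS : V ⊆ S52)
    (h : IsLocallyFiniteClass V) : IsLocallyFiniteClass (translate V hS) := by
  intro B hB
  obtain ⟨C, ι, D, g, f, hD, hg, hf⟩ := mem_HSP_iff.1 hB
  choose A hA hsi hDA using hD
  obtain rfl : D = fun i => translateAlg (A i) (hS (hA i)) := funext hDA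
  have hprod : Alg.prod A ∈ V :=
    hV.opP_subset ⟨ι, A, hA, Alg.Hom.id _, Function.bijective_id⟩
  exact ((isLocallyFinite_prod_translateAlg (fun i => hS (hA i)) hsi (h _ hprod)).of_injective
    (Alg.Hom.pi g) fun x y h => hg x y fun i => congrFun h i).of_surjective f hf

theorem isLocallyFiniteClass_of_translate {V : Set Alg.{u}} (hV : IsVariety V) (hS : V ⊆ S52)
    (h : IsLocallyFiniteClass (translate V hS)) : IsLocallyFiniteClass V := by
  intro B hB
  obtain ⟨ι, A, f, hf, hsi, hsep⟩ := B.exists_subdirect_representation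
  have hA : ∀ i, A i ∈ V := fun i => hV.opH_subset ⟨B, hB, f i, hf i⟩
  exact isLocallyFinite_of_prod_translateAlg (fun i => hS (hA i))
    (h _ (mem_HSP_of_forall_mem fun i => ⟨A i, hA i, hsi i, rfl⟩)) f hsep

theorem translate_subset_MS4SDepth {V : Set Alg.{u}} (hS : V ⊆ S52) :
    translate V hS ⊆ MS4SDepth 2 := by
  refine HSP_subset_MS4SDepth ?_
  rintro _ ⟨A, hA, -, rfl⟩
  exact (dualFrame A (hS hA)).topRail_dual_mem_MS4SDepth

end Bimodal

theorem mainTheorem1 (V : Set Bimodal.Alg.{u}) (hV : Bimodal.IsVariety V)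
    (hS : V ⊆ Bimodal.S52) :
    Bimodal.IsVariety (Bimodal.translate V hS) ∧
      Bimodal.translate V hS ⊆ Bimodal.MS4SDepth 2 ∧
      (Bimodal.IsLocallyFiniteClass V ↔
        Bimodal.IsLocallyFiniteClass (Bimodal.translate V hS)) :=
  ⟨Bimodal.isVariety_HSP _, Bimodal.translate_subset_MS4SDepth hS,
    Bimodal.translate_isLocallyFiniteClass hV hS, Bimodal.isLocallyFiniteClass_of_translate hV hS⟩
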